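/- A \emph{coloured graph} $G=(V,w)$ consists of a finite vertex set $V$ and a symmetric function $w\colon V^2\to\{0,1,2\}$ with $w(x,x)=0$ for all $x\in V$; the edge between two distinct vertices $x,y$ is called green, blue, or red if $w(x,y)$ is $0$, $1$, or $2$, respectively. The degree of $x$ is $d(x)=\sum_{y\in V}w(x,y)$, and $\delta(G)=\min_{x\in V}d(x)$. A subgraph of $G$ is a coloured graph $(V',w')$ with $V'\subseteq V$ and $w'(x,y)\le w(x,y)$ for all $x,y\in V'$; $G$ is $F$-free if it has no subgraph isomorphic to $F$, and $\mathscr F$-free if it is $F$-free for every $F\in\mathscr F$. A homomorphism from $(V,w)$ to $(V',w')$ is a map $\varphi\colon V\to V'$ with $w(x,y)\le w'(\varphi(x),\varphi(y))$ for all distinct $x,y\in V$. For integers $a\ge b\ge 1$ let $G_{a+b,b}$ be the coloured graph of order $a$ consisting of a red clique on $b$ vertices and a blue clique on $a-b$ vertices that are connected to each other by blue edges, and let $\mathscr F_t=\{G_{t,i}\colon 1\le i\le t/2\}$. For $r\ge 2$ let $RK_r^-$ be the red clique on $r$ vertices with one edge recoloured blue. \textbf{Theorem.} Let $r\ge 3$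 be an integer. (1) If $G$ is an $\mathscr F_{2r}$-free coloured graph on $n$ vertices with $\delta(G)>\frac{14r-24}{7r-5}\,n$, then there is a homomorphism from $G$ to $RK_r^-$. In other words, there is a partition $V(G)=W_1\mathbin{\dot\cup}\dots\mathbin{\dot\cup}W_r$ (into possibly empty classes) such that all edges within the classes are green and no edge from $W_1$ to $W_2$ is red; for every coloured graph, the existence of such a partition is equivalent to the existence of a homomorphism to $RK_r^-$. (2) The constant is optimal: for every positive multiple $n$ of $7r-5$ there is an $\mathscr F_{2r}$-free coloured graph $G$ on $n$ vertices with $\delta(G)=\frac{14r-24}{7r-5}\,n$ that has no homomorphism to $RK_r^-$. Consequently $\frac{14r-24}{7r-5}$ is the least real number $\alpha$ such that every $\mathscr F_{2r}$-free coloured graph $G$ on $n$ vertices with $\delta(G)>\alpha n$ has a homomorphism to $RK_r^-$. -/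

import Mathlib

/-- A coloured graph on `V`: a weighted graph with weights in `{0, 1, 2}`. Distinct vertices
`x, y` are joined by a green, blue or red edge according to whether `w x y` is `0`, `1` or `2`. -/
structure ColouredGraph (V : Type*) where
  w : V → V → ℕ
  symm : ∀ x y, w x y = w y x
  loopless : ∀ x, w x x = 0
  le_two : ∀ x y, w x y ≤ 2

namespace ColouredGraph

/-- `H`, whose vertex set is the subset `S` of `V`, is a subgraph of `G`. -/
def IsSubgraph {V : Type*} {S : Set V} (H : ColouredGraph S) (G : ColouredGraph V) : Prop :=
  ∀ x y : S, H.w x y ≤ G.w x y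

/-- `F` and `H` are isomorphic. -/
def Isomorphic {U V : Type*} (F : ColouredGraph U) (H : ColouredGraph V) : Prop :=
  ∃ φ : U ≃ V, ∀ x y, F.w x y = H.w (φ x) (φ y)

/-- `G` is `F`-free: no subgraph of `G` is isomorphic to `F`. -/
def Free {U V : Type*} (F : ColouredGraph U) (G : ColouredGraph V) : Prop :=
  ¬ ∃ (S : Set V) (H : ColouredGraph S), H.IsSubgraph G ∧ F.Isomorphic H

/-- `G` is `𝓕`-free for a set `𝓕` of (finite) coloured graphs. -/
def FamilyFree {V : Type*} (𝓕 : Set (Σ m : ℕ, ColouredGraph (Fin m)))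
    (G : ColouredGraph V) : Prop :=
  ∀ F ∈ 𝓕, Free F.2 G

/-- The coloured graph `G_{a+b,b}` of order `a`: a red clique on the first `b` vertices, a blue
clique on the other `a - b` vertices, and blue edges between the two. -/
def cliqueGraph (a b : ℕ) : ColouredGraph (Fin a) where
  w x y := if x = y then 0 else if x.val < b ∧ y.val < b then 2 else 1
  symm x y := by simp only [eq_comm (a := x), and_comm (a := x.val < b)]
  loopless x := by simp
  le_two x y := by split_ifs <;> omega

/-- The family `𝓕_t = {G_{t,i} : 1 ≤ i ≤ t/2}`, where `G_{t,i} = G_{a+b,b}` with `b = i` and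
`a + b = t`. -/
def family (t : ℕ) : Set (Σ m : ℕ, ColouredGraph (Fin m)) :=
  {F | ∃ a b : ℕ, 1 ≤ b ∧ b ≤ a ∧ a + b = t ∧ F = ⟨a, cliqueGraph a b⟩}

/-- `RK_r⁻` (for `r ≥ 2`): the red clique on `r` vertices with the edge between the vertices
`0` and `1` recoloured blue. -/
def redCliqueMinus (r : ℕ) : ColouredGraph (Fin r) where
  w x y := if x = y then 0 else if x.val < 2 ∧ y.val < 2 then 1 else 2
  symm x y := by simp only [eq_comm (a := x), and_comm (a := x.val < 2)]
  loopless x := by simp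
  le_two x y := by split_ifs <;> omega

/-- The degree of a vertex. -/
def degree {V : Type*} [Fintype V] (G : ColouredGraph V) (x : V) : ℕ :=
  ∑ y, G.w x y

/-- The minimum degree (`0` if there are no vertices). -/
noncomputable def minDegree {V : Type*} [Fintype V] (G : ColouredGraph V) : ℕ :=
  ⨅ x, G.degree x

/-- `φ` is a homomorphism from `G` to `H`. -/
def IsHom {U V : Type*} (G : ColouredGraph U) (H : ColouredGraph V) (φ : U → V) : Prop :=
  ∀ x y, x ≠ y → G.w x y ≤ H.w (φ x) (φ y)

/-- There is a homomorphism from `G` to `H`. -/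
def HasHom {U V : Type*} (G : ColouredGraph U) (H : ColouredGraph V) : Prop :=
  ∃ φ : U → V, G.IsHom H φ

/-- The classes `W 0, …, W (r - 1)` are disjoint with union `V`, all edges inside a class are
green, and no edge from `W 0` to `W 1` is red. -/
def IsMinusPartition {V : Type*} (G : ColouredGraph V) {r : ℕ} (W : Fin r → Set V) : Prop :=
  (∀ i j, i ≠ j → Disjoint (W i) (W j)) ∧
  (⋃ i, W i) = Set.univ ∧
  (∀ i, ∀ x ∈ W i, ∀ y ∈ W i, x ≠ y → G.w x y = 0) ∧
  (∀ i j : Fin r, i.val = 0 → j.val = 1 → ∀ x ∈ W i, ∀ y ∈ W j, G.w x y ≠ 2)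

end ColouredGraph

/-! Write r = m + 2 and give every vertex the same mass so that the total mass is 7r - 5 = 7m + 9.
The degree hypothesis then says that the gaps 2 - w(v,z), summed over z, have mass below 14 at every
vertex v. Being free of the family is used only through `CliqueBound`: a green-free clique and a
nonempty red clique inside it have at most 2r - 1 vertices together.

A copy of `RK_r⁻`, called a `Frame`, exists by a Motzkin–Straus argument. A minimiser of the
quadratic form of gaps on the simplex, chosen with smallest support, lives on a green-free clique
and equalises the gaps there; `CliqueBound` then leaves only one possible shape for that clique
(`nonempty_frame`).

Every vertex is green to some vertex of a given frame (`exists_green`), and a red edge to an end of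
the blue edge forces a further non-red edge (`exists_nonred`). Summing weighted versions of these
local facts over all vertices bounds the masses of the vertex types below (`six_lt_classB`,
`twelve_lt_classA`) and shows that few vertices have no type (`stray_lt_one`). The configuration
that governs the constant is excluded by `not_skew`.

If a frame maximises the score of z, then a missing edge from z to a frame vertex propagates to the
whole class of that vertex; comparing with 14 forces z to be exchangeable into the frame
(`exists_frame_of_mem`). Vertices of type b have green mass above 6 (heavy), those of type a do not
(light). Heavy vertices split into m green classes according to the class of a fixed frame that they
are mostly green to (`green_of_label`). Light vertices span no red edge and no green-free triangle,
have mass at least 9, and are joined to more than 4/9 of each other; since 4/9 > 2/5, the Andrásfai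
theorem makes them bipartite.

For sharpness, two classes of mass 2 and two of mass 6 carry exactly the configuration excluded by
`not_skew`, and m - 1 further classes of mass 7 are red to everything else. -/

open Finset

/-! ### Clique bounds and frames -/

namespace ColouredGraph

variable {V : Type*}

/-- Every clique `Q` without green edges and every nonempty red clique `R ⊆ Q` satisfy
`#Q + #R < t`. -/
def CliqueBound (G : ColouredGraph V) (t : ℕ) : Prop :=
  ∀ Q R : Finset V, R ⊆ Q → R.Nonempty →
    (∀ x ∈ Q, ∀ y ∈ Q, x ≠ y → G.w x y ≠ 0) →
    (∀ x ∈ R, ∀ y ∈ R, x ≠ y → G.w x y = 2) → #Q + #R < t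

theorem not_free_of_injective {G : ColouredGraph V} {a b : ℕ} (f : Fin a → V)
    (hf : Function.Injective f) (hblue : ∀ i j, i ≠ j → G.w (f i) (f j) ≠ 0)
    (hred : ∀ i j : Fin a, i ≠ j → i.val < b → j.val < b → G.w (f i) (f j) = 2) :
    ¬ Free (cliqueGraph a b) G := by
  intro h
  let e : Fin a ≃ Set.range f := Equiv.ofInjective f hf
  refine h ⟨Set.range f,
    { w := fun x y => (cliqueGraph a b).w (e.symm x) (e.symm y)
      symm := fun x y => (cliqueGraph a b).symm _ _
      loopless := fun x => (cliqueGraph a b).loopless _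
      le_two := fun x y => (cliqueGraph a b).le_two _ _ }, ?_, e, by simp⟩
  intro x y
  obtain ⟨i, rfl⟩ := e.surjective x
  obtain ⟨j, rfl⟩ := e.surjective y
  simp only [Equiv.symm_apply_apply, cliqueGraph]
  have hi : (e i : V) = f i := rfl
  have hj : (e j : V) = f j := rfl
  rw [hi, hj]
  split_ifs with h1 h2
  · exact Nat.zero_le _
  · exact (hred i j h1 h2.1 h2.2).ge
  · exact Nat.one_le_iff_ne_zero.2 (hblue i j h1)

theorem FamilyFree.cliqueBound {G : ColouredGraph V} {r : ℕ} (hr : 1 ≤ r)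
    (hG : G.FamilyFree (family (2 * r))) : G.CliqueBound (2 * r) := by
  classical
  intro Q R hRQ hR hQb hRr
  by_contra hcon
  push Not at hcon
  have hRQc := card_le_card hRQ
  have hRpos := hR.card_pos
  obtain ⟨a, b, hb, hba, hab, haQ, hbR⟩ :
      ∃ a b, 1 ≤ b ∧ b ≤ a ∧ a + b = 2 * r ∧ a ≤ #Q ∧ b ≤ #R := by
    -- A red clique with at least r vertices is cut down to r of them; otherwise all of R is kept
    -- and Q is trimmed to the complementary size.
    by_cases h : r ≤ #R
    · exact ⟨r, r, hr, le_rfl, by omega, by omega, h⟩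
    · exact ⟨2 * r - #R, #R, by omega, by omega, by omega, by omega, by omega⟩
  obtain ⟨R', hR'R, hR'⟩ := exists_subset_card_eq hbR
  obtain ⟨Q', hRQ', hQ'Q, hQ'⟩ := exists_subsuperset_card_eq (hR'R.trans hRQ) (by omega) haQ
  have hT : #(Q' \ R') = a - b := by rw [card_sdiff_of_subset hRQ', hQ', hR']
  let eR := R'.equivFinOfCardEq hR'
  let eT := (Q' \ R').equivFinOfCardEq hT
  let f : Fin a → V := fun i => if h : i.val < b then eR.symm ⟨i, h⟩
    else eT.symm ⟨i - b, by omega⟩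
  have hfR : ∀ i : Fin a, i.val < b → f i ∈ R' := by
    intro i hi; simp only [f, hi, dite_true]; exact (eR.symm _).2
  have hfT : ∀ i : Fin a, ¬ i.val < b → f i ∈ Q' \ R' := by
    intro i hi; simp only [f, hi, dite_false]; exact (eT.symm _).2
  have hfQ : ∀ i, f i ∈ Q' := by
    intro i
    by_cases hi : i.val < b
    · exact hRQ' (hfR i hi)
    · exact (mem_sdiff.1 (hfT i hi)).1
  have hinj : Function.Injective f := by
    intro i j hij
    by_cases hi : i.val < b <;> by_cases hj : j.val < b
    · simp only [f, hi, hj, dite_true] at hij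
      have := eR.symm.injective (Subtype.ext hij)
      simp at this; omega
    · exact absurd (hij ▸ hfR i hi) (mem_sdiff.1 (hfT j hj)).2
    · exact absurd (hij ▸ hfR j hj) (mem_sdiff.1 (hfT i hi)).2
    · simp only [f, hi, hj, dite_false] at hij
      have := eT.symm.injective (Subtype.ext hij)
      simp at this; omega
  exact not_free_of_injective f hinj
    (fun i j hij => hQb _ (hQ'Q (hfQ i)) _ (hQ'Q (hfQ j)) (hinj.ne hij))
    (fun i j hij hi hj => hRr _ (hR'R (hfR i hi)) _ (hR'R (hfR j hj)) (hinj.ne hij))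
    (hG ⟨a, cliqueGraph a b⟩ ⟨a, b, hb, hba, hab, rfl⟩)

theorem ne_of_w_ne_zero {G : ColouredGraph V} {x y : V} (h : G.w x y ≠ 0) : x ≠ y := by
  rintro rfl; exact h (G.loopless _)

/-- A copy of `RK_r⁻` in `G`, where `r = #ι + 2`: the edge `a₁a₂` is blue and all other edges
are red. -/
structure Frame (G : ColouredGraph V) (ι : Type*) where
  a₁ : V
  a₂ : V
  b : ι → V
  w_a : G.w a₁ a₂ = 1
  w_a₁ : ∀ i, G.w a₁ (b i) = 2
  w_a₂ : ∀ i, G.w a₂ (b i) = 2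
  w_b : ∀ i j, i ≠ j → G.w (b i) (b j) = 2

namespace Frame

variable {G : ColouredGraph V} {ι : Type*}

/-- Exchange the two vertices joined by the blue edge. -/
def flip (K : Frame G ι) : Frame G ι :=
  ⟨K.a₂, K.a₁, K.b, by rw [G.symm]; exact K.w_a, K.w_a₂, K.w_a₁, K.w_b⟩

/-- The vertices that are green to `a₁`, blue to `a₂`, and red to all `b i`. -/
def IsA (K : Frame G ι) (v : V) : Prop :=
  G.w v K.a₁ = 0 ∧ G.w v K.a₂ = 1 ∧ ∀ i, G.w v (K.b i) = 2

/-- The vertices that are red to all vertices of `K` except possibly `b i`. -/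
def IsB (K : Frame G ι) (i : ι) (v : V) : Prop :=
  G.w v K.a₁ = 2 ∧ G.w v K.a₂ = 2 ∧ ∀ j, j ≠ i → G.w v (K.b j) = 2

theorem b_injective (K : Frame G ι) : Function.Injective K.b := by
  intro i j h
  by_contra hij
  have := K.w_b i j hij
  rw [h, G.loopless] at this
  omega

/-- Replace `a₁` by another vertex of its class. -/
def setA (K : Frame G ι) (v : V) (hv : G.w v K.a₂ = 1) (hb : ∀ i, G.w v (K.b i) = 2) :
    Frame G ι :=
  ⟨v, K.a₂, K.b, hv, hb, K.w_a₂, K.w_b⟩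

/-- Replace `b i` by another vertex of its class. -/
def setB [DecidableEq ι] (K : Frame G ι) (i : ι) (v : V) (hv : K.IsB i v) : Frame G ι where
  a₁ := K.a₁
  a₂ := K.a₂
  b := Function.update K.b i v
  w_a := K.w_a
  w_a₁ j := by
    by_cases h : j = i
    · subst h; rw [Function.update_self, G.symm]; exact hv.1
    · rw [Function.update_of_ne h]; exact K.w_a₁ j
  w_a₂ j := by
    by_cases h : j = i
    · subst h; rw [Function.update_self, G.symm]; exact hv.2.1
    · rw [Function.update_of_ne h]; exact K.w_a₂ j
  w_b j k hjk := by
    by_cases h : j = i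
    · subst h; rw [Function.update_self, Function.update_of_ne hjk.symm]; exact hv.2.2 k hjk.symm
    · by_cases h' : k = i
      · subst h'; rw [Function.update_self, Function.update_of_ne h, G.symm]; exact hv.2.2 j h
      · rw [Function.update_of_ne h, Function.update_of_ne h']; exact K.w_b j k hjk

theorem isA_a₁ (K : Frame G ι) : K.IsA K.a₁ := ⟨G.loopless _, K.w_a, K.w_a₁⟩

theorem isB_b (K : Frame G ι) (i : ι) : K.IsB i (K.b i) :=
  ⟨by rw [G.symm]; exact K.w_a₁ i, by rw [G.symm]; exact K.w_a₂ i,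
    fun j hj => K.w_b i j hj.symm⟩

variable [Fintype ι]

/-- Otherwise v together with the frame is a green-free clique on r + 1 vertices, and `a₁` with all
`b i` is a red clique of r - 1 vertices inside it. -/
theorem exists_green (K : Frame G ι) (hG : G.CliqueBound (2 * Fintype.card ι + 4)) (v : V) :
    G.w v K.a₁ = 0 ∨ G.w v K.a₂ = 0 ∨ ∃ i, G.w v (K.b i) = 0 := by
  classical
  by_contra! hcon
  obtain ⟨h1, h2, h3⟩ := hcon
  have ha₁ : K.a₁ ∉ univ.image K.b := by
    simp only [mem_image, mem_univ, true_and, not_exists]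
    intro i h; have := K.w_a₁ i; rw [h, G.loopless] at this; omega
  have ha₂ : K.a₂ ∉ insert K.a₁ (univ.image K.b) := by
    simp only [mem_insert, mem_image, mem_univ, true_and, not_or, not_exists]
    refine ⟨fun h => ?_, fun i h => ?_⟩
    · have := K.w_a; rw [h, G.loopless] at this; omega
    · have := K.w_a₂ i; rw [h, G.loopless] at this; omega
  have hv : v ∉ insert K.a₂ (insert K.a₁ (univ.image K.b)) := by
    simp only [mem_insert, mem_image, mem_univ, true_and, not_or, not_exists]
    exact ⟨ne_of_w_ne_zero h2, ne_of_w_ne_zero h1, fun i h => ne_of_w_ne_zero (h3 i) h.symm⟩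
  have hcard : #(univ.image K.b) = Fintype.card ι := card_image_of_injective _ K.b_injective
  have := hG (insert v (insert K.a₂ (insert K.a₁ (univ.image K.b)))) (insert K.a₁ (univ.image K.b))
    (fun x hx => mem_insert_of_mem (mem_insert_of_mem hx)) (insert_nonempty _ _) ?_ ?_
  · rw [card_insert_of_notMem hv, card_insert_of_notMem ha₂, card_insert_of_notMem ha₁, hcard] at this
    omega
  · have w1 := K.w_a
    have w2 := K.w_a₁
    have w3 := K.w_a₂
    have w4 := K.w_b
    have w1' : G.w K.a₂ K.a₁ = 1 := by rw [G.symm]; exact w1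
    have w2' : ∀ i, G.w (K.b i) K.a₁ = 2 := fun i => by rw [G.symm]; exact w2 i
    have w3' : ∀ i, G.w (K.b i) K.a₂ = 2 := fun i => by rw [G.symm]; exact w3 i
    have h1' : G.w K.a₁ v ≠ 0 := by rw [G.symm]; exact h1
    have h2' : G.w K.a₂ v ≠ 0 := by rw [G.symm]; exact h2
    have h3' : ∀ i, G.w (K.b i) v ≠ 0 := fun i => by rw [G.symm]; exact h3 i
    simp only [mem_insert, mem_image, mem_univ, true_and]
    rintro x (rfl | rfl | rfl | ⟨i, rfl⟩) y (rfl | rfl | rfl | ⟨j, rfl⟩) hxy <;>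
      first
      | exact absurd rfl hxy
      | assumption
      | (have := w4 i j (fun h => hxy (h ▸ rfl)); omega)
      | simp_all
  · have w2 := K.w_a₁
    have w4 := K.w_b
    have w2' : ∀ i, G.w (K.b i) K.a₁ = 2 := fun i => by rw [G.symm]; exact w2 i
    simp only [mem_insert, mem_image, mem_univ, true_and]
    rintro x (rfl | ⟨i, rfl⟩) y (rfl | ⟨j, rfl⟩) hxy
    · exact absurd rfl hxy
    · exact w2 j
    · exact w2' i
    · exact w4 i j (fun h => hxy (h ▸ rfl))

/-- Otherwise v, `a₁` and all `b i` form a red clique on r vertices, which violates the bound when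
used as both cliques. -/
theorem exists_nonred (K : Frame G ι) (hG : G.CliqueBound (2 * Fintype.card ι + 4)) (v : V)
    (hv : G.w v K.a₁ = 2) : ∃ i, G.w v (K.b i) ≠ 2 := by
  classical
  by_contra! h3
  have ha₁ : K.a₁ ∉ univ.image K.b := by
    simp only [mem_image, mem_univ, true_and, not_exists]
    intro i h; have := K.w_a₁ i; rw [h, G.loopless] at this; omega
  have hv' : v ∉ insert K.a₁ (univ.image K.b) := by
    simp only [mem_insert, mem_image, mem_univ, true_and, not_or, not_exists]
    exact ⟨ne_of_w_ne_zero (G := G) (by omega),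
      fun i h => ne_of_w_ne_zero (G := G) (by rw [h3 i]; omega) h.symm⟩
  have hcard : #(univ.image K.b) = Fintype.card ι := card_image_of_injective _ K.b_injective
  have hred : ∀ x ∈ insert v (insert K.a₁ (univ.image K.b)),
      ∀ y ∈ insert v (insert K.a₁ (univ.image K.b)), x ≠ y → G.w x y = 2 := by
    have w2 := K.w_a₁
    have w4 := K.w_b
    have w2' : ∀ i, G.w (K.b i) K.a₁ = 2 := fun i => by rw [G.symm]; exact w2 i
    have hv1 : G.w K.a₁ v = 2 := by rw [G.symm]; exact hv
    have h3' : ∀ i, G.w (K.b i) v = 2 := fun i => by rw [G.symm]; exact h3 i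
    simp only [mem_insert, mem_image, mem_univ, true_and]
    rintro x (rfl | rfl | ⟨i, rfl⟩) y (rfl | rfl | ⟨j, rfl⟩) hxy <;>
      first
      | exact absurd rfl hxy
      | assumption
      | exact w4 i j (fun h => hxy (h ▸ rfl))
      | simp_all
  have := hG _ _ (Subset.refl _) (insert_nonempty _ _)
    (fun x hx y hy hxy => by rw [hred x hx y hy hxy]; omega) hred
  rw [card_insert_of_notMem hv', card_insert_of_notMem ha₁, hcard] at this
  omega

theorem IsB.green {K : Frame G ι} {i : ι} {v : V} (hv : K.IsB i v)
    (hG : G.CliqueBound (2 * Fintype.card ι + 4)) : G.w v (K.b i) = 0 := by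
  rcases K.exists_green hG v with h | h | ⟨j, h⟩
  · have := hv.1; omega
  · have := hv.2.1; omega
  · by_cases hj : j = i
    · exact hj ▸ h
    · have := hv.2.2 j hj; omega

/-- Put v in place of `b i`; u still has type `i` for the new frame, so it is green to v. -/
theorem IsB.w_eq_zero {K : Frame G ι} {i : ι} {u v : V} (hu : K.IsB i u) (hv : K.IsB i v)
    (hG : G.CliqueBound (2 * Fintype.card ι + 4)) : G.w u v = 0 := by
  classical
  have h : (K.setB i v hv).IsB i u :=
    ⟨hu.1, hu.2.1, fun j hj => by simpa [setB, hj] using hu.2.2 j hj⟩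
  simpa [setB] using h.green hG

theorem IsA.w_eq_zero {K : Frame G ι} {u v : V} (hu : K.IsA u) (hv : K.IsA v)
    (hG : G.CliqueBound (2 * Fintype.card ι + 4)) : G.w u v = 0 := by
  rcases (K.setA v hv.2.1 hv.2.2).exists_green hG u with h | h | ⟨j, h⟩
  · exact h
  · have := hu.2.1; simp only [setA] at h; omega
  · have := hu.2.2 j; simp only [setA] at h; omega

theorem IsA.w_ne_two {K : Frame G ι} {u v : V} (hu : K.IsA u) (hv : K.flip.IsA v)
    (hG : G.CliqueBound (2 * Fintype.card ι + 4)) : G.w v u ≠ 2 := by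
  intro h
  obtain ⟨i, hi⟩ := (K.setA u hu.2.1 hu.2.2).exists_nonred hG v h
  exact hi (hv.2.2 i)

end Frame

end ColouredGraph

/-! ### Gap counting and the excluded configuration -/

namespace ColouredGraph

variable {V : Type*}

theorem gap_nonneg (G : ColouredGraph V) (x y : V) : 0 ≤ 2 - (G.w x y : ℝ) := by
  have : (G.w x y : ℝ) ≤ 2 := by exact_mod_cast G.le_two x y
  linarith

theorem one_le_gap {G : ColouredGraph V} {x y : V} (h : G.w x y ≠ 2) :
    1 ≤ 2 - (G.w x y : ℝ) := by
  have h2 := G.le_two x y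
  have : (G.w x y : ℝ) ≤ 1 := by exact_mod_cast (by omega : G.w x y ≤ 1)
  linarith

theorem gap_eq_two {G : ColouredGraph V} {x y : V} (h : G.w x y = 0) :
    2 - (G.w x y : ℝ) = 2 := by
  rw [h]; norm_num

namespace Frame

variable {G : ColouredGraph V} {ι : Type*} [Fintype ι]

/-- The total weight missing between `v` and the vertices `b i`. -/
def gap (K : Frame G ι) (v : V) : ℝ := ∑ i, (2 - (G.w v (K.b i) : ℝ))

theorem gap_nonneg (K : Frame G ι) (v : V) : 0 ≤ K.gap v :=
  sum_nonneg fun _ _ => ColouredGraph.gap_nonneg G _ _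

theorem le_gap (K : Frame G ι) (v : V) (i : ι) : 2 - (G.w v (K.b i) : ℝ) ≤ K.gap v :=
  single_le_sum (f := fun i => 2 - (G.w v (K.b i) : ℝ))
    (fun _ _ => ColouredGraph.gap_nonneg G _ _) (mem_univ i)

theorem add_le_gap (K : Frame G ι) (v : V) {i j : ι} (hij : i ≠ j) :
    (2 - (G.w v (K.b i) : ℝ)) + (2 - (G.w v (K.b j) : ℝ)) ≤ K.gap v :=
  add_le_sum (f := fun i => 2 - (G.w v (K.b i) : ℝ))
    (fun _ _ => ColouredGraph.gap_nonneg G _ _) (mem_univ i) (mem_univ j) hij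

end Frame

variable [Fintype V]

/-- The hypothesis on `G` with `r = m + 2`, normalised so that every vertex has mass `c` and the
total mass is `7r - 5`. -/
structure IsDense (G : ColouredGraph V) (m : ℕ) (c : ℝ) : Prop where
  pos : 0 < c
  total : c * Fintype.card V = 7 * m + 9
  deficit_lt : ∀ v, c * ∑ z, (2 - (G.w v z : ℝ)) < 14
  cliqueBound : G.CliqueBound (2 * m + 4)

theorem IsDense.deficit_lt' {G : ColouredGraph V} {m : ℕ} {c : ℝ} (hD : G.IsDense m c) (v : V) :
    c * ∑ z, (2 - (G.w z v : ℝ)) < 14 := by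
  simpa only [G.symm v] using hD.deficit_lt v

theorem IsDense.three_sets {G : ColouredGraph V} {m : ℕ} {c : ℝ} (hD : G.IsDense m c) (z : V)
    {S T U : Finset V} (hST : Disjoint S T) (hSU : Disjoint S U) (hTU : Disjoint T U)
    {p q s : ℝ} (hS : ∀ u ∈ S, p ≤ 2 - (G.w z u : ℝ)) (hT : ∀ u ∈ T, q ≤ 2 - (G.w z u : ℝ))
    (hU : ∀ u ∈ U, s ≤ 2 - (G.w z u : ℝ)) :
    p * (c * #S) + q * (c * #T) + s * (c * #U) < 14 := by
  classical
  have h1 : ∑ u ∈ S ∪ T ∪ U, (2 - (G.w z u : ℝ)) ≤ ∑ u, (2 - (G.w z u : ℝ)) :=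
    sum_le_sum_of_subset_of_nonneg (subset_univ _) fun u _ _ => gap_nonneg G z u
  rw [sum_union (disjoint_union_left.2 ⟨hSU, hTU⟩), sum_union hST] at h1
  have h2 := card_nsmul_le_sum S _ _ hS
  have h3 := card_nsmul_le_sum T _ _ hT
  have h4 := card_nsmul_le_sum U _ _ hU
  simp only [nsmul_eq_mul] at h2 h3 h4
  have h5 := hD.deficit_lt z
  have h6 := mul_le_mul_of_nonneg_left (add_le_add (add_le_add h2 h3) h4) hD.pos.le
  have h7 := mul_le_mul_of_nonneg_left h1 hD.pos.le
  linarith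

theorem IsDense.two_sets {G : ColouredGraph V} {m : ℕ} {c : ℝ} (hD : G.IsDense m c) (z : V)
    {S T : Finset V} (hST : Disjoint S T)
    {p q : ℝ} (hS : ∀ u ∈ S, p ≤ 2 - (G.w z u : ℝ)) (hT : ∀ u ∈ T, q ≤ 2 - (G.w z u : ℝ)) :
    p * (c * #S) + q * (c * #T) < 14 := by
  have := hD.three_sets z hST (disjoint_empty_right S) (disjoint_empty_right T) hS hT
    (s := 0) (by simp)
  simpa using this

theorem IsDense.sum_indicator (c : ℝ) (P : V → Prop) [DecidablePred P] :
    c * ∑ z, (if P z then (1 : ℝ) else 0) = c * #{z | P z} := by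
  rw [Finset.sum_boole]

namespace Frame

variable {G : ColouredGraph V} {ι : Type*} [Fintype ι]

variable {c : ℝ}

theorem sum_gap_le (K : Frame G ι) (hD : G.IsDense (Fintype.card ι) c) :
    c * ∑ z, K.gap z ≤ 14 * Fintype.card ι := by
  unfold gap
  rw [sum_comm, mul_sum]
  calc _ ≤ ∑ _i : ι, (14 : ℝ) := sum_le_sum fun i _ => (hD.deficit_lt' (K.b i)).le
    _ = _ := by simp [mul_comm]

theorem sum_gap_erase_le (K : Frame G ι) (hD : G.IsDense (Fintype.card ι) c) (i : ι) :
    c * ∑ z, (K.gap z - (2 - (G.w z (K.b i) : ℝ))) ≤ 14 * (Fintype.card ι - 1) := by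
  classical
  have e : ∀ z, K.gap z - (2 - (G.w z (K.b i) : ℝ))
      = ∑ j ∈ univ.erase i, (2 - (G.w z (K.b j) : ℝ)) := by
    intro z
    rw [gap, ← add_sum_erase univ _ (mem_univ i)]
    ring
  simp only [e]
  rw [sum_comm, mul_sum]
  calc _ ≤ ∑ _j ∈ univ.erase i, (14 : ℝ) := sum_le_sum fun j _ => (hD.deficit_lt' (K.b j)).le
    _ = _ := by
      have : 0 < Fintype.card ι := Fintype.card_pos_iff.2 ⟨i⟩
      rw [sum_const, card_erase_of_mem (mem_univ i), card_univ, nsmul_eq_mul,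
        Nat.cast_pred this]
      ring

/-- The frame `(x, b i | a₂, b j)` obtained from `(a₁, a₂ | b)`. -/
def skew [DecidableEq ι] (K : Frame G ι) (i : ι) (x : V) (h2 : G.w x K.a₂ = 2)
    (hi : G.w x (K.b i) = 1) (hj : ∀ j, j ≠ i → G.w x (K.b j) = 2) : Frame G ι where
  a₁ := x
  a₂ := K.b i
  b := Function.update K.b i K.a₂
  w_a := hi
  w_a₁ j := by
    by_cases h : j = i
    · subst h; rwa [Function.update_self]
    · rw [Function.update_of_ne h]; exact hj j h
  w_a₂ j := by
    by_cases h : j = i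
    · subst h; rw [Function.update_self, G.symm]; exact K.w_a₂ j
    · rw [Function.update_of_ne h]; exact K.w_b i j (Ne.symm h)
  w_b j k hjk := by
    by_cases h : j = i
    · subst h; rw [Function.update_self, Function.update_of_ne hjk.symm]; exact K.w_a₂ k
    · by_cases h' : k = i
      · subst h'; rw [Function.update_self, Function.update_of_ne h, G.symm]; exact K.w_a₂ j
      · rw [Function.update_of_ne h, Function.update_of_ne h']; exact K.w_b j k hjk

/-- Here `K` and its skew frame are two copies of `RK_r⁻` that differ in one vertex and have
disjoint blue edges. Weight the gaps at `a₁`, x by 2, at `a₂`, `b i` by 6 and at every other `b j`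
by 7, as in the extremal graph. Each vertex then collects at least 14, while the weights sum to 7m +
9, the total mass; so the average gap mass over these vertices would be at least 14. -/
theorem not_skew (K : Frame G ι) (hD : G.IsDense (Fintype.card ι) c) (x : V) (i : ι)
    (h2 : G.w x K.a₂ = 2) (hi : G.w x (K.b i) = 1) (hj : ∀ j, j ≠ i → G.w x (K.b j) = 2) :
    False := by
  classical
  have hG := hD.cliqueBound
  have key : ∀ v, (14 : ℝ) ≤ 2 * (2 - (G.w v K.a₁ : ℝ)) + 2 * (2 - (G.w v x : ℝ))
      + 6 * (2 - (G.w v K.a₂ : ℝ)) + 7 * K.gap v - (2 - (G.w v (K.b i) : ℝ)) := by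
    intro v
    have n1 := ColouredGraph.gap_nonneg G v K.a₁
    have nx := ColouredGraph.gap_nonneg G v x
    have n2 := ColouredGraph.gap_nonneg G v K.a₂
    have ni := ColouredGraph.gap_nonneg G v (K.b i)
    have gi := K.le_gap v i
    by_cases hgreen : ∃ j, j ≠ i ∧ G.w v (K.b j) = 0
    · obtain ⟨j, hji, h0⟩ := hgreen
      have := K.add_le_gap v hji
      rw [gap_eq_two h0] at this
      linarith
    push Not at hgreen
    by_cases h20 : G.w v K.a₂ = 0
    · have e2 := gap_eq_two h20
      by_cases h1 : G.w v K.a₁ = 2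
      · obtain ⟨j, hj'⟩ := K.exists_nonred hG v h1
        have := one_le_gap hj'
        have := K.le_gap v j
        linarith
      · have := one_le_gap h1
        linarith
    by_cases hi0 : G.w v (K.b i) = 0
    · have ei := gap_eq_two hi0
      by_cases hx : G.w v x = 2
      · obtain ⟨j, hj'⟩ := (K.skew i x h2 hi hj).exists_nonred hG v hx
        by_cases hji : j = i
        · subst hji
          simp only [skew, Function.update_self] at hj'
          have := one_le_gap hj'
          linarith
        · simp only [skew, Function.update_of_ne hji] at hj'
          have := one_le_gap hj'
          have := K.add_le_gap v hji
          linarith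
      · have := one_le_gap hx
        linarith
    have h10 : G.w v K.a₁ = 0 := by
      rcases K.exists_green hG v with h | h | ⟨j, h⟩
      · exact h
      · exact absurd h h20
      · by_cases hji : j = i
        · exact absurd (hji ▸ h) hi0
        · exact absurd h (hgreen j hji)
    have hx0 : G.w v x = 0 := by
      rcases (K.skew i x h2 hi hj).exists_green hG v with h | h | ⟨j, h⟩
      · exact h
      · exact absurd h hi0
      · by_cases hji : j = i
        · subst hji
          simp only [skew, Function.update_self] at h
          exact absurd h h20
        · simp only [skew, Function.update_of_ne hji] at h
          exact absurd h (hgreen j hji)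
    have e1 := gap_eq_two h10
    have ex := gap_eq_two hx0
    by_cases h22 : G.w v K.a₂ = 2
    · obtain ⟨j, hj'⟩ := K.flip.exists_nonred hG v h22
      have hj1 := one_le_gap hj'
      by_cases hji : j = i
      · subst hji
        change 1 ≤ 2 - (G.w v (K.b j) : ℝ) at hj1
        linarith
      · have := K.add_le_gap v hji
        change 1 ≤ 2 - (G.w v (K.b j) : ℝ) at hj1
        linarith
    · have := one_le_gap h22
      linarith
  have hsum := mul_le_mul_of_nonneg_left (sum_le_sum fun v (_ : v ∈ univ) => key v) hD.pos.le
  simp only [sum_sub_distrib, sum_add_distrib, ← mul_sum, sum_const, card_univ, nsmul_eq_mul]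
    at hsum
  have t1 := hD.deficit_lt' K.a₁
  have tx := hD.deficit_lt' x
  have t2 := hD.deficit_lt' K.a₂
  have ti := hD.deficit_lt' (K.b i)
  have hb := K.sum_gap_erase_le hD i
  have ht := hD.total
  simp only [sum_sub_distrib, sum_const, card_univ, nsmul_eq_mul] at *
  linarith

end Frame

end ColouredGraph

/-! ### Masses of the classes of a frame -/

namespace ColouredGraph

variable {V : Type*} [Fintype V]

namespace Frame

variable {G : ColouredGraph V} {ι : Type*}

open Classical in
/-- The set of vertices of the type of `a₁`. -/
noncomputable def classA (K : Frame G ι) : Finset V := {v | K.IsA v}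

open Classical in
/-- The set of vertices of the type of `b i`. -/
noncomputable def classB (K : Frame G ι) (i : ι) : Finset V := {v | K.IsB i v}

theorem mem_classA {K : Frame G ι} {v : V} : v ∈ K.classA ↔ K.IsA v := by simp [classA]

theorem mem_classB {K : Frame G ι} {i : ι} {v : V} : v ∈ K.classB i ↔ K.IsB i v := by
  simp [classB]

theorem disjoint_classA_flip (K : Frame G ι) : Disjoint K.classA K.flip.classA := by
  rw [disjoint_left]
  intro v h1 h2
  rw [mem_classA] at h1 h2
  have h3 := h1.1
  have h4 : G.w v K.a₁ = 1 := h2.2.1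
  omega

theorem disjoint_classA_classB (K : Frame G ι) (i : ι) : Disjoint K.classA (K.classB i) := by
  rw [disjoint_left]
  intro v h1 h2
  rw [mem_classA] at h1
  rw [mem_classB] at h2
  have h3 := h1.1
  have h4 := h2.1
  omega

theorem flip_classB (K : Frame G ι) (i : ι) : K.flip.classB i = K.classB i := by
  ext u
  simp only [mem_classB, IsB, flip]
  tauto

theorem disjoint_classB [Fintype ι] (K : Frame G ι)
    (hG : G.CliqueBound (2 * Fintype.card ι + 4)) {i j : ι} (hij : i ≠ j) :
    Disjoint (K.classB i) (K.classB j) := by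
  rw [disjoint_left]
  intro v h1 h2
  rw [mem_classB] at h1 h2
  have h3 := h1.green hG
  have h4 := h2.2.2 i hij
  omega

variable [Fintype ι] {c : ℝ}

/-- Gaps are weighted by 2 at `a₁`, `a₂`, `b i` and by 3 at the other `b j`. Every vertex collects
6, except that those in the class collect 4. The weights sum to 3m + 3, so less than 42m + 42 is
available where 6(7m + 9) = 42m + 54 is needed; the class covers the shortage of 12 at rate 2. -/
theorem six_lt_classB (K : Frame G ι) (hD : G.IsDense (Fintype.card ι) c) (i : ι) :
    6 < c * #(K.classB i) := by
  classical
  have hG := hD.cliqueBound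
  have key : ∀ v, (6 : ℝ) ≤ 2 * (if K.IsB i v then 1 else 0) + 2 * (2 - (G.w v K.a₁ : ℝ))
      + 2 * (2 - (G.w v K.a₂ : ℝ)) + 3 * K.gap v - (2 - (G.w v (K.b i) : ℝ)) := by
    intro v
    have n1 := ColouredGraph.gap_nonneg G v K.a₁
    have n2 := ColouredGraph.gap_nonneg G v K.a₂
    have gi := K.le_gap v i
    by_cases hB : K.IsB i v
    · have := gap_eq_two (hB.green hG)
      rw [if_pos hB]
      linarith
    rw [if_neg hB]
    by_cases hi0 : G.w v (K.b i) = 0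
    · have e := gap_eq_two hi0
      by_cases h1 : G.w v K.a₁ = 2
      · by_cases h2 : G.w v K.a₂ = 2
        · obtain ⟨j, hji, hj⟩ : ∃ j, j ≠ i ∧ G.w v (K.b j) ≠ 2 := by
            by_contra! h; exact hB ⟨h1, h2, h⟩
          have := one_le_gap hj
          have := K.add_le_gap v hji
          linarith
        · have := one_le_gap h2
          linarith
      · have := one_le_gap h1
        linarith
    by_cases hgreen : ∃ j, j ≠ i ∧ G.w v (K.b j) = 0
    · obtain ⟨j, hji, h0⟩ := hgreen
      have := K.add_le_gap v hji
      have := ColouredGraph.gap_nonneg G v (K.b i)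
      rw [gap_eq_two h0] at *
      linarith
    push Not at hgreen
    have hb : ∀ (_ : ∃ j, G.w v (K.b j) ≠ 2), 2 ≤ 3 * K.gap v - (2 - (G.w v (K.b i) : ℝ)) := by
      rintro ⟨j, hj⟩
      have := one_le_gap hj
      by_cases hji : j = i
      · subst hji; linarith
      · have := K.add_le_gap v hji
        have := ColouredGraph.gap_nonneg G v (K.b i)
        linarith
    have ni : 0 ≤ 3 * K.gap v - (2 - (G.w v (K.b i) : ℝ)) := by
      have := K.gap_nonneg v
      linarith
    rcases K.exists_green hG v with h | h | ⟨j, h⟩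
    · have e := gap_eq_two h
      by_cases h2 : G.w v K.a₂ = 2
      · have := hb (K.flip.exists_nonred hG v h2)
        linarith
      · have := one_le_gap h2
        linarith
    · have e := gap_eq_two h
      by_cases h2 : G.w v K.a₁ = 2
      · have := hb (K.exists_nonred hG v h2)
        linarith
      · have := one_le_gap h2
        linarith
    · by_cases hji : j = i
      · exact absurd (hji ▸ h) hi0
      · exact absurd h (hgreen j hji)
  have hsum := mul_le_mul_of_nonneg_left (sum_le_sum fun v (_ : v ∈ univ) => key v) hD.pos.le
  have hb : c * ∑ z, (K.gap z - (2 - (G.w z (K.b i) : ℝ))) ≤ 14 * (Fintype.card ι - 1) :=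
    K.sum_gap_erase_le hD i
  have hind := IsDense.sum_indicator c (K.IsB i)
  have t1 := hD.deficit_lt' K.a₁
  have t2 := hD.deficit_lt' K.a₂
  have ti := hD.deficit_lt' (K.b i)
  have ht := hD.total
  have hcl : #(K.classB i) = #{z | K.IsB i z} := by simp [classB]
  rw [hcl]
  simp only [sum_sub_distrib, sum_add_distrib, ← mul_sum, sum_const, card_univ, nsmul_eq_mul]
    at *
  linarith

/-- The possible ways in which a vertex green to `a₁` but not to any `b i` is joined to `K`. -/
theorem green_a₁_cases (K : Frame G ι) (hD : G.IsDense (Fintype.card ι) c) {v : V}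
    (h1 : G.w v K.a₁ = 0) (hb : ∀ i, G.w v (K.b i) ≠ 0) :
    K.IsA v ∨ G.w v K.a₂ = 0 ∨ (G.w v K.a₂ = 1 ∧ ∃ i, G.w v (K.b i) ≠ 2) ∨
      ∃ i j, i ≠ j ∧ G.w v (K.b i) ≠ 2 ∧ G.w v (K.b j) ≠ 2 := by
  have hle := G.le_two v K.a₂
  by_cases h22 : G.w v K.a₂ = 2
  · obtain ⟨i, hi⟩ := K.flip.exists_nonred hD.cliqueBound v h22
    change G.w v (K.b i) ≠ 2 at hi
    have hi1 : G.w v (K.b i) = 1 := by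
      have := hb i; have := G.le_two v (K.b i); omega
    by_contra! hcon
    refine K.not_skew hD v i h22 hi1 fun j hj => ?_
    by_contra hj2
    exact hj2 (hcon.2.2.2 i j (Ne.symm hj) hi)
  by_cases h20 : G.w v K.a₂ = 0
  · exact Or.inr (Or.inl h20)
  have h21 : G.w v K.a₂ = 1 := by omega
  by_cases h : ∃ i, G.w v (K.b i) ≠ 2
  · exact Or.inr (Or.inr (Or.inl ⟨h21, h⟩))
  · push Not at h
    exact Or.inl ⟨h1, h21, h⟩

/-- The same count with weights 1, 2, 3 at `a₁`, `a₂` and the `b i`. The sum is again 3m + 3, and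
the shortage of 12 is covered at rates 2 and 1 by the types of `a₁` and `a₂`. The problematic
vertices, red to `a₂` with a single blue edge to the `b i`, are removed by `not_skew`. -/
theorem twelve_lt_classA (K : Frame G ι) (hD : G.IsDense (Fintype.card ι) c) :
    12 < 2 * (c * #K.classA) + c * #K.flip.classA := by
  classical
  have hG := hD.cliqueBound
  have key : ∀ v, (6 : ℝ) ≤ 2 * (if K.IsA v then 1 else 0) + (if K.flip.IsA v then 1 else 0)
      + (2 - (G.w v K.a₁ : ℝ)) + 2 * (2 - (G.w v K.a₂ : ℝ)) + 3 * K.gap v := by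
    intro v
    have n1 := ColouredGraph.gap_nonneg G v K.a₁
    have n2 := ColouredGraph.gap_nonneg G v K.a₂
    have ng := K.gap_nonneg v
    have i1 : (0 : ℝ) ≤ if K.IsA v then 1 else 0 := by split_ifs <;> norm_num
    have i2 : (0 : ℝ) ≤ if K.flip.IsA v then 1 else 0 := by split_ifs <;> norm_num
    by_cases hgreen : ∃ j, G.w v (K.b j) = 0
    · obtain ⟨j, h0⟩ := hgreen
      have := K.le_gap v j
      rw [gap_eq_two h0] at this
      linarith
    push Not at hgreen
    have hnon : ∀ j, G.w v (K.b j) ≠ 2 → 1 ≤ K.gap v := fun j hj =>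
      (one_le_gap hj).trans (K.le_gap v j)
    have htwo : ∀ i j, i ≠ j → G.w v (K.b i) ≠ 2 → G.w v (K.b j) ≠ 2 → 2 ≤ K.gap v := by
      intro i j hij hi hj
      have := K.add_le_gap v hij
      have := one_le_gap hi
      have := one_le_gap hj
      linarith
    rcases K.exists_green hG v with h | h | ⟨j, h⟩
    · have e := gap_eq_two h
      rcases K.green_a₁_cases hD h hgreen with hA | h2 | ⟨h2, j, hj⟩ | ⟨i, j, hij, hi, hj⟩
      · rw [if_pos hA] at *
        have := one_le_gap (G := G) (x := v) (y := K.a₂) (by rw [hA.2.1]; omega)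
        linarith
      · have := gap_eq_two h2
        linarith
      · have := hnon j hj
        have := one_le_gap (G := G) (x := v) (y := K.a₂) (by omega)
        linarith
      · have := htwo i j hij hi hj
        linarith
    · have e := gap_eq_two h
      rcases K.flip.green_a₁_cases hD h hgreen with hA | h2 | ⟨h2, j, hj⟩ | ⟨i, j, hij, hi, hj⟩
      · rw [if_pos hA] at *
        have h1 : G.w v K.a₁ = 1 := hA.2.1
        have := one_le_gap (G := G) (x := v) (y := K.a₁) (by omega)
        linarith
      · have h2 : G.w v K.a₁ = 0 := h2
        have := gap_eq_two h2
        linarith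
      · have := hnon j hj
        linarith
      · have := htwo i j hij hi hj
        linarith
    · exact absurd h (hgreen j)
  have hsum := mul_le_mul_of_nonneg_left (sum_le_sum fun v (_ : v ∈ univ) => key v) hD.pos.le
  have hb := K.sum_gap_le hD
  have hind := IsDense.sum_indicator c K.IsA
  have hind' := IsDense.sum_indicator c K.flip.IsA
  have t1 := hD.deficit_lt' K.a₁
  have t2 := hD.deficit_lt' K.a₂
  have ht := hD.total
  have hcl : #(K.classA) = #{z | K.IsA z} := by simp [classA]
  have hcl' : #(K.flip.classA) = #{z | K.flip.IsA z} := by simp [classA]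
  rw [hcl, hcl']
  simp only [sum_sub_distrib, sum_add_distrib, ← mul_sum, sum_const, card_univ, nsmul_eq_mul]
    at *
  linarith

/-- The gap at `a₂` is 2 on its own class and 1 on that of `a₁`, which bounds the class of `a₂` from
above in `twelve_lt_classA`. -/
theorem ten_lt_classA (K : Frame G ι) (hD : G.IsDense (Fintype.card ι) c) :
    10 < 3 * (c * #K.classA) := by
  have h1 := K.twelve_lt_classA hD
  have h2 : 2 * (c * #K.flip.classA) + 1 * (c * #K.classA) < 14 := by
    refine hD.two_sets K.a₂ K.disjoint_classA_flip.symm (fun u hu => ?_) (fun u hu => ?_)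
    · rw [G.symm]; exact (gap_eq_two (mem_classA.1 hu).1).ge
    · rw [G.symm]; exact one_le_gap (by rw [(mem_classA.1 hu).2.1]; omega)
  linarith

theorem eight_lt_classA (K : Frame G ι) (hD : G.IsDense (Fintype.card ι) c) :
    8 < c * #K.classA + c * #K.flip.classA := by
  have h1 := K.twelve_lt_classA hD
  have h2 := K.flip.twelve_lt_classA hD
  have h3 : K.flip.flip = K := rfl
  rw [h3] at h2
  linarith

/-- The vertices that belong to none of the classes of `K`. -/
def IsStray (K : Frame G ι) (v : V) : Prop :=
  ¬ K.IsA v ∧ ¬ K.flip.IsA v ∧ ∀ i, ¬ K.IsB i v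

-- With weights 2, 2, 3 every vertex collects 6 and every stray one 8. Now less than 14(3m + 4) is
-- available, which exceeds 6(7m + 9) by only 2.
open Classical in
theorem stray_lt_one (K : Frame G ι) (hD : G.IsDense (Fintype.card ι) c) :
    c * #{v | K.IsStray v} < 1 := by
  have hG := hD.cliqueBound
  have key : ∀ v, (6 : ℝ) + 2 * (if K.IsStray v then 1 else 0) ≤
      2 * (2 - (G.w v K.a₁ : ℝ)) + 2 * (2 - (G.w v K.a₂ : ℝ)) + 3 * K.gap v := by
    intro v
    have n1 := ColouredGraph.gap_nonneg G v K.a₁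
    have n2 := ColouredGraph.gap_nonneg G v K.a₂
    have ng := K.gap_nonneg v
    have hind : (if K.IsStray v then (1 : ℝ) else 0) ≤ 1 := by split_ifs <;> norm_num
    by_cases hgreen : ∃ i, G.w v (K.b i) = 0
    · obtain ⟨i, h0⟩ := hgreen
      have e := gap_eq_two h0
      have gi := K.le_gap v i
      by_cases hB : K.IsB i v
      · rw [if_neg fun h => h.2.2 i hB]
        linarith
      by_cases h1 : G.w v K.a₁ = 2
      · by_cases h2 : G.w v K.a₂ = 2
        · obtain ⟨j, hji, hj⟩ : ∃ j, j ≠ i ∧ G.w v (K.b j) ≠ 2 := by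
            by_contra! h; exact hB ⟨h1, h2, h⟩
          have := one_le_gap hj
          have := K.add_le_gap v hji
          linarith
        · have := one_le_gap h2
          linarith
      · have := one_le_gap h1
        linarith
    push Not at hgreen
    have hnon : ∀ j, G.w v (K.b j) ≠ 2 → 1 ≤ K.gap v := fun j hj =>
      (one_le_gap hj).trans (K.le_gap v j)
    have htwo : ∀ i j, i ≠ j → G.w v (K.b i) ≠ 2 → G.w v (K.b j) ≠ 2 → 2 ≤ K.gap v := by
      intro i j hij hi hj
      have := K.add_le_gap v hij
      have := one_le_gap hi
      have := one_le_gap hj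
      linarith
    rcases K.exists_green hG v with h | h | ⟨j, h⟩
    · have e := gap_eq_two h
      rcases K.green_a₁_cases hD h hgreen with hA | h2 | ⟨h2, j, hj⟩ | ⟨i, j, hij, hi, hj⟩
      · rw [if_neg fun h => h.1 hA] at *
        have := one_le_gap (G := G) (x := v) (y := K.a₂) (by rw [hA.2.1]; omega)
        linarith
      · have := gap_eq_two h2
        linarith
      · have := hnon j hj
        have := one_le_gap (G := G) (x := v) (y := K.a₂) (by omega)
        linarith
      · have := htwo i j hij hi hj
        linarith
    · have e := gap_eq_two h
      rcases K.flip.green_a₁_cases hD h hgreen with hA | h2 | ⟨h2, j, hj⟩ | ⟨i, j, hij, hi, hj⟩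
      · rw [if_neg fun h => h.2.1 hA] at *
        have h1 : G.w v K.a₁ = 1 := hA.2.1
        have := one_le_gap (G := G) (x := v) (y := K.a₁) (by omega)
        linarith
      · have h2 : G.w v K.a₁ = 0 := h2
        have := gap_eq_two h2
        linarith
      · have := hnon j hj
        have h2 : G.w v K.a₁ = 1 := h2
        have := one_le_gap (G := G) (x := v) (y := K.a₁) (by omega)
        linarith
      · have := htwo i j hij hi hj
        linarith
    · exact absurd h (hgreen j)
  have hsum := mul_le_mul_of_nonneg_left (sum_le_sum fun v (_ : v ∈ univ) => key v) hD.pos.le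
  have hb := K.sum_gap_le hD
  have hind := IsDense.sum_indicator c K.IsStray
  have t1 := hD.deficit_lt' K.a₁
  have t2 := hD.deficit_lt' K.a₂
  have ht := hD.total
  simp only [sum_sub_distrib, sum_add_distrib, ← mul_sum, sum_const, card_univ, nsmul_eq_mul]
    at *
  linarith

end Frame

end ColouredGraph

/-! ### Score-maximal frames; heavy and light vertices -/

namespace ColouredGraph

variable {V : Type*}

theorem gap_ge_one_of_le {G : ColouredGraph V} {u v z : V} (h : G.w z u ≤ G.w z v)
    (hv : G.w z v ≠ 2) : 1 ≤ 2 - (G.w z u : ℝ) :=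
  one_le_gap (by have := G.le_two z v; omega)

theorem gap_ge_two_of_le {G : ColouredGraph V} {u v z : V} (h : G.w z u ≤ G.w z v)
    (hv : G.w z v = 0) : 2 ≤ 2 - (G.w z u : ℝ) :=
  (gap_eq_two (by omega)).ge

namespace Frame

variable {G : ColouredGraph V} {ι : Type*} [Fintype ι]

/-- A weighted degree of `z` into `K`. -/
def score (K : Frame G ι) (z : V) : ℕ :=
  2 * G.w z K.a₁ + 2 * G.w z K.a₂ + 3 * ∑ i, G.w z (K.b i)

theorem score_le (K : Frame G ι) (z : V) : K.score z ≤ 8 + 6 * Fintype.card ι := by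
  have h : ∑ i, G.w z (K.b i) ≤ ∑ _i : ι, 2 := sum_le_sum fun i _ => G.le_two _ _
  have h1 := G.le_two z K.a₁
  have h2 := G.le_two z K.a₂
  simp only [sum_const, card_univ, smul_eq_mul] at h
  unfold score
  omega

theorem exists_max_score {P : Frame G ι → Prop} (hP : ∃ K, P K) (z : V) :
    ∃ K, P K ∧ ∀ K', P K' → K'.score z ≤ K.score z := by
  obtain ⟨K, hK, hmin⟩ :=
    (measure fun K : Frame G ι => 8 + 6 * Fintype.card ι - K.score z).wf.has_min {K | P K} hP
  refine ⟨K, hK, fun K' hK' => ?_⟩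
  have h := hmin K' hK'
  have := K.score_le z
  have := K'.score_le z
  by_contra hlt
  exact h (show 8 + 6 * Fintype.card ι - K'.score z < 8 + 6 * Fintype.card ι - K.score z by omega)

theorem w_le_of_score_setB [DecidableEq ι] {K : Frame G ι} {i : ι} {u z : V} {hu : K.IsB i u}
    (h : (K.setB i u hu).score z ≤ K.score z) : G.w z u ≤ G.w z (K.b i) := by
  have h1 : ∑ j, G.w z ((K.setB i u hu).b j) = G.w z u + ∑ j ∈ univ.erase i, G.w z (K.b j) := by
    rw [← add_sum_erase univ _ (mem_univ i)]
    congr 1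
    · simp [setB]
    · exact sum_congr rfl fun j hj => by simp [setB, ne_of_mem_erase hj]
  have h2 := add_sum_erase univ (fun j => G.w z (K.b j)) (mem_univ i)
  simp only [score, h1] at h
  simp only [setB] at h
  omega

theorem w_le_of_score_setA {K : Frame G ι} {u z : V} {hu : G.w u K.a₂ = 1}
    {hb : ∀ i, G.w u (K.b i) = 2}
    (h : (K.setA u hu hb).score z ≤ K.score z) : G.w z u ≤ G.w z K.a₁ := by
  simp only [score, setA] at h
  omega

theorem flip_score (K : Frame G ι) (z : V) : K.flip.score z = K.score z := by
  simp only [score, flip]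
  ring

end Frame

variable [Fintype V]

open Classical in
/-- The set of vertices joined to `v` by a green edge, including `v`. -/
noncomputable def green (G : ColouredGraph V) (v : V) : Finset V := {u | G.w v u = 0}

theorem mem_green {G : ColouredGraph V} {u v : V} : u ∈ G.green v ↔ G.w v u = 0 := by
  simp [green]

/-- The green neighbourhood of `v` has mass more than `6`. -/
def IsHeavy (G : ColouredGraph V) (c : ℝ) (v : V) : Prop := 6 < c * #(G.green v)

namespace Frame

variable {G : ColouredGraph V} {ι : Type*} [Fintype ι] {c : ℝ}

/-- By the maximality assumptions, each gap from z to a frame vertex holds against that vertex's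
whole class. In every alternative of `green_a₁_cases` other than the desired one, the class masses
give z a gap mass above 14. -/
theorem isA_of_green (K : Frame G ι) (hD : G.IsDense (Fintype.card ι) c) {z : V}
    (hA : ∀ u ∈ K.classA, G.w z u ≤ G.w z K.a₁)
    (hA' : ∀ u ∈ K.flip.classA, G.w z u ≤ G.w z K.a₂)
    (hB : ∀ i, ∀ u ∈ K.classB i, G.w z u ≤ G.w z (K.b i))
    (h1 : G.w z K.a₁ = 0) (hb : ∀ i, G.w z (K.b i) ≠ 0) : K.IsA z := by
  have s12 := K.twelve_lt_classA hD
  have s10 := K.ten_lt_classA hD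
  have s8 := K.eight_lt_classA hD
  have hA2 : ∀ u ∈ K.classA, 2 ≤ 2 - (G.w z u : ℝ) := fun u hu => gap_ge_two_of_le (hA u hu) h1
  rcases K.green_a₁_cases hD h1 hb with h | h2 | ⟨h2, j, hj⟩ | ⟨i, j, hij, hi, hj⟩
  · exact h
  · have := hD.two_sets z K.disjoint_classA_flip hA2
      (fun u hu => gap_ge_two_of_le (hA' u hu) h2)
    linarith
  · have sj := K.six_lt_classB hD j
    have := hD.three_sets z K.disjoint_classA_flip (K.disjoint_classA_classB j)
      (K.flip.disjoint_classA_classB j |>.mono_right fun u hu => by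
        rw [mem_classB] at hu ⊢; exact ⟨hu.2.1, hu.1, hu.2.2⟩) hA2
      (fun u hu => gap_ge_one_of_le (hA' u hu) (by omega))
      (fun u hu => gap_ge_one_of_le (hB j u hu) hj)
    linarith
  · have si := K.six_lt_classB hD i
    have sj := K.six_lt_classB hD j
    have := hD.three_sets z (K.disjoint_classA_classB i) (K.disjoint_classA_classB j)
      (K.disjoint_classB hD.cliqueBound hij) hA2
      (fun u hu => gap_ge_one_of_le (hB i u hu) hi)
      (fun u hu => gap_ge_one_of_le (hB j u hu) hj)
    linarith

theorem isB_of_green (K : Frame G ι) (hD : G.IsDense (Fintype.card ι) c) {z : V}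
    (hA : ∀ u ∈ K.classA, G.w z u ≤ G.w z K.a₁)
    (hA' : ∀ u ∈ K.flip.classA, G.w z u ≤ G.w z K.a₂)
    (hB : ∀ i, ∀ u ∈ K.classB i, G.w z u ≤ G.w z (K.b i))
    {i : ι} (hi : G.w z (K.b i) = 0) : K.IsB i z := by
  have si := K.six_lt_classB hD i
  have hB2 : ∀ u ∈ K.classB i, 2 ≤ 2 - (G.w z u : ℝ) := fun u hu => gap_ge_two_of_le (hB i u hu) hi
  refine ⟨?_, ?_, fun j hj => ?_⟩
  · by_contra h
    have := K.ten_lt_classA hD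
    have := hD.two_sets z (K.disjoint_classA_classB i)
      (fun u hu => gap_ge_one_of_le (hA u hu) h) hB2
    linarith
  · by_contra h
    have := K.flip.ten_lt_classA hD
    have hd := K.flip.disjoint_classA_classB i
    rw [flip_classB] at hd
    have := hD.two_sets z hd (fun u hu => gap_ge_one_of_le (hA' u hu) h) hB2
    linarith
  · by_contra h
    have := K.six_lt_classB hD j
    have := hD.two_sets z (K.disjoint_classB hD.cliqueBound hj)
      (fun u hu => gap_ge_one_of_le (hB j u hu) h) hB2
    linarith

/-- Take a frame with maximal score for z. Since z is green to one of its vertices, z has that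
vertex's type and can replace it. -/
theorem exists_frame_of_mem (hD : G.IsDense (Fintype.card ι) c) (K₀ : Frame G ι) (z : V) :
    (∃ K : Frame G ι, K.a₁ = z) ∨ ∃ (K : Frame G ι) (i : ι), K.b i = z := by
  classical
  obtain ⟨K, -, hK⟩ := exists_max_score (P := fun _ : Frame G ι => True) ⟨K₀, trivial⟩ z
  have hA : ∀ u ∈ K.classA, G.w z u ≤ G.w z K.a₁ := fun u hu =>
    w_le_of_score_setA (hu := (mem_classA.1 hu).2.1) (hb := (mem_classA.1 hu).2.2)
      (hK _ trivial)
  have hA' : ∀ u ∈ K.flip.classA, G.w z u ≤ G.w z K.a₂ := fun u hu =>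
    w_le_of_score_setA (K := K.flip) (hu := (mem_classA.1 hu).2.1) (hb := (mem_classA.1 hu).2.2)
      (by rw [flip_score]; exact hK _ trivial)
  have hB : ∀ i, ∀ u ∈ K.classB i, G.w z u ≤ G.w z (K.b i) := fun i u hu =>
    w_le_of_score_setB (hu := mem_classB.1 hu) (hK _ trivial)
  by_cases hb : ∃ i, G.w z (K.b i) = 0
  · obtain ⟨i, hi⟩ := hb
    have h := K.isB_of_green hD hA hA' hB hi
    exact Or.inr ⟨K.setB i z h, i, by simp [setB]⟩
  push Not at hb
  rcases K.exists_green hD.cliqueBound z with h | h | ⟨i, h⟩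
  · have h := K.isA_of_green hD hA hA' hB h hb
    exact Or.inl ⟨K.setA z h.2.1 h.2.2, rfl⟩
  · have h := K.flip.isA_of_green hD hA' hA (fun i u hu => hB i u (K.flip_classB i ▸ hu)) h hb
    exact Or.inl ⟨K.flip.setA z h.2.1 h.2.2, rfl⟩
  · exact absurd h (hb i)

theorem IsB.isHeavy {K : Frame G ι} {i : ι} {v : V} (hv : K.IsB i v)
    (hD : G.IsDense (Fintype.card ι) c) : G.IsHeavy c v := by
  refine (K.six_lt_classB hD i).trans_le ?_
  refine mul_le_mul_of_nonneg_left ?_ hD.pos.le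
  exact_mod_cast card_le_card fun u hu =>
    mem_green.2 (hv.w_eq_zero (mem_classB.1 hu) hD.cliqueBound)

/-- No vertex of the two a-classes, of joint mass above 8, is red to v. Counting 1 for each of them
and one more for each green neighbour would give a gap mass above 8 + 6 = 14. -/
theorem IsA.not_isHeavy {K : Frame G ι} {v : V} (hv : K.IsA v)
    (hD : G.IsDense (Fintype.card ι) c) : ¬ G.IsHeavy c v := by
  classical
  intro h
  have h8 := K.eight_lt_classA hD
  have hG := hD.cliqueBound
  have hsub : K.classA ⊆ G.green v := fun u hu =>
    mem_green.2 (hv.w_eq_zero (mem_classA.1 hu) hG)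
  have hd : Disjoint (G.green v) (K.flip.classA \ G.green v) := disjoint_sdiff
  have := hD.two_sets v hd (p := 2) (q := 1) (fun u hu => (gap_eq_two (mem_green.1 hu)).ge)
    (fun u hu => one_le_gap fun h2 => (hv.w_ne_two (mem_classA.1 (mem_sdiff.1 hu).1) hG)
      (by rw [G.symm]; exact h2))
  have hle : #K.classA + #K.flip.classA ≤ #(G.green v) + #(K.flip.classA \ G.green v) := by
    rw [← card_union_of_disjoint K.disjoint_classA_flip, ← card_union_of_disjoint hd]
    refine card_le_card fun u hu => ?_
    rcases mem_union.1 hu with hu | hu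
    · exact mem_union_left _ (hsub hu)
    · by_cases hg : u ∈ G.green v
      · exact mem_union_left _ hg
      · exact mem_union_right _ (mem_sdiff.2 ⟨hu, hg⟩)
  have hle' : (#K.classA : ℝ) + #K.flip.classA ≤ #(G.green v) + #(K.flip.classA \ G.green v) := by
    exact_mod_cast hle
  have := mul_le_mul_of_nonneg_left hle' hD.pos.le
  unfold IsHeavy at h
  linarith

theorem exists_a₁_eq (hD : G.IsDense (Fintype.card ι) c) (K₀ : Frame G ι) {z : V}
    (hz : ¬ G.IsHeavy c z) : ∃ K : Frame G ι, K.a₁ = z := by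
  rcases exists_frame_of_mem hD K₀ z with h | ⟨K, i, rfl⟩
  · exact h
  · exact absurd ((K.isB_b i).isHeavy hD) hz

theorem exists_b_eq (hD : G.IsDense (Fintype.card ι) c) (K₀ : Frame G ι) {z : V}
    (hz : G.IsHeavy c z) : ∃ (K : Frame G ι) (i : ι), K.b i = z := by
  rcases exists_frame_of_mem hD K₀ z with ⟨K, rfl⟩ | h
  · exact absurd hz (K.isA_a₁.not_isHeavy hD)
  · exact h

theorem disjoint_of_heavy (hD : G.IsDense (Fintype.card ι) c) (K K' : Frame G ι) (i : ι) :
    Disjoint K.classA (K'.classB i) := by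
  rw [disjoint_left]
  intro u h1 h2
  exact (mem_classA.1 h1).not_isHeavy hD ((mem_classB.1 h2).isHeavy hD)

/-- A light vertex has a red neighbour in each class `B i`. -/
theorem exists_red_of_light (hD : G.IsDense (Fintype.card ι) c) (K : Frame G ι) {y : V}
    (hy : ¬ G.IsHeavy c y) (i : ι) : ∃ u ∈ K.classB i, G.w y u = 2 := by
  by_contra! hcon
  obtain ⟨K', rfl⟩ := exists_a₁_eq hD K hy
  -- The a-classes of `K'` contribute more than 12 and the class of `b i` in `K` more than 6; they
  -- are disjoint because one side is light and the other heavy.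
  have := hD.three_sets K'.a₁ K'.disjoint_classA_flip (disjoint_of_heavy hD K' K i)
    (disjoint_of_heavy hD K'.flip K i) (p := 2) (q := 1) (s := 1)
    (fun u hu => by rw [G.symm]; exact (gap_eq_two (mem_classA.1 hu).1).ge)
    (fun u hu => by
      have h : G.w u K'.a₁ = 1 := (mem_classA.1 hu).2.1
      rw [G.symm]; exact one_le_gap (by omega))
    (fun u hu => one_le_gap (hcon u hu))
  have := K'.twelve_lt_classA hD
  have := K.six_lt_classB hD i
  linarith

/-- A frame with prescribed `a₁` all of whose vertices `b i` are red to a given light vertex. -/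
theorem exists_red_frame (hD : G.IsDense (Fintype.card ι) c) {y : V} (hy : ¬ G.IsHeavy c y)
    (K₀ : Frame G ι) :
    ∃ K : Frame G ι, K.a₁ = K₀.a₁ ∧ K.a₂ = K₀.a₂ ∧ ∀ i, G.w y (K.b i) = 2 := by
  classical
  obtain ⟨K, ⟨h1, h2⟩, hK⟩ := exists_max_score
    (P := fun K : Frame G ι => K.a₁ = K₀.a₁ ∧ K.a₂ = K₀.a₂) ⟨K₀, rfl, rfl⟩ y
  refine ⟨K, h1, h2, fun i => ?_⟩
  obtain ⟨u, hu, hyu⟩ := exists_red_of_light hD K hy i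
  have := w_le_of_score_setB (hu := mem_classB.1 hu) (hK _ ⟨h1, h2⟩)
  have := G.le_two y (K.b i)
  omega

/-- A frame through x at `a₁` can be chosen with all `b i` red to y, so a red edge xy would complete
a red clique on r vertices. -/
theorem light_not_red (hD : G.IsDense (Fintype.card ι) c) (K₀ : Frame G ι) {x y : V}
    (hx : ¬ G.IsHeavy c x) (hy : ¬ G.IsHeavy c y) : G.w y x ≠ 2 := by
  intro h
  obtain ⟨K, rfl⟩ := exists_a₁_eq hD K₀ hx
  obtain ⟨K', h1, -, hb⟩ := exists_red_frame hD hy K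
  obtain ⟨i, hi⟩ := K'.exists_nonred hD.cliqueBound y (by rw [h1]; exact h)
  exact hi (hb i)

/-- The edge xy is blue, so some frame has x and y as the ends of its blue edge. Changing the `b i`
to be red to z leaves z green to no vertex of that frame. -/
theorem light_no_triangle (hD : G.IsDense (Fintype.card ι) c) (K₀ : Frame G ι) {x y z : V}
    (hx : ¬ G.IsHeavy c x) (hy : ¬ G.IsHeavy c y) (hz : ¬ G.IsHeavy c z)
    (hxy : G.w y x ≠ 0) (hxz : G.w z x ≠ 0) (hyz : G.w z y ≠ 0) : False := by
  have hne := light_not_red hD K₀ hx hy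
  have hle := G.le_two y x
  have h1 : G.w y x = 1 := by omega
  obtain ⟨K, rfl⟩ := exists_a₁_eq hD K₀ hx
  obtain ⟨K₁, e₁, -, hb⟩ := exists_red_frame hD hy K
  let K₂ : Frame G ι := K₁.flip.setA y (by change G.w y K₁.a₁ = 1; rw [e₁]; exact h1) hb
  obtain ⟨K₃, f₁, f₂, hb₃⟩ := exists_red_frame hD hz K₂
  rcases K₃.exists_green hD.cliqueBound z with h | h | ⟨i, h⟩
  · rw [f₁] at h; exact hyz h
  · rw [f₂] at h
    change G.w z K₁.a₁ = 0 at h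
    rw [e₁] at h; exact hxz h
  · have := hb₃ i; omega

end Frame

end ColouredGraph

/-! ### Green classes of heavy vertices and bipartition of the light ones -/

namespace ColouredGraph

variable {V : Type*} [Fintype V]

theorem IsDense.green_lt {G : ColouredGraph V} {m : ℕ} {c : ℝ} (hD : G.IsDense m c) {z : V}
    {S : Finset V} (hS : ∀ u ∈ S, G.w z u = 0) : c * #S < 7 := by
  have := hD.two_sets z (disjoint_empty_right S) (p := 2) (q := 0)
    (fun u hu => (gap_eq_two (hS u hu)).ge) (by simp)
  simp only [card_empty, Nat.cast_zero, mul_zero, add_zero] at this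
  linarith

/-- A subset of the green neighbourhood of `z` is almost contained in every other subset of mass
more than `6`. -/
theorem IsDense.green_sdiff_lt [DecidableEq V] {G : ColouredGraph V} {m : ℕ} {c : ℝ}
    (hD : G.IsDense m c)
    {z : V} {S T : Finset V} (hS : ∀ u ∈ S, G.w z u = 0) (hT : ∀ u ∈ T, G.w z u = 0)
    (h6 : 6 < c * #S) : c * #T - 1 < c * #(T ∩ S) := by
  have h7 := hD.green_lt (S := S ∪ T) (z := z)
    (fun u hu => (mem_union.1 hu).elim (hS u) (hT u))
  have h8 : (#(S ∪ T) : ℝ) + #(T ∩ S) = #S + #T := by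
    rw [inter_comm]; exact_mod_cast card_union_add_card_inter S T
  have h9 := congrArg (c * ·) h8
  linarith

namespace Frame

variable {G : ColouredGraph V} {ι : Type*} [Fintype ι] {c : ℝ}

open Classical in
/-- Every heavy vertex is green to most of one of the classes `B i` of a fixed frame. -/
theorem exists_label (hD : G.IsDense (Fintype.card ι) c) (K₀ : Frame G ι) {v : V}
    (hv : G.IsHeavy c v) : ∃ i, 5 < c * #(G.green v ∩ K₀.classB i) := by
  have hG := hD.cliqueBound
  obtain ⟨K, j, rfl⟩ := exists_b_eq hD K₀ hv
  have h6 := K.six_lt_classB hD j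
  -- A class of mass above 6 consists of heavy vertices, hence meets neither a-class of `K₀`, and it
  -- cannot consist of strays alone. Both b-classes containing u lie in its green neighbourhood, of
  -- mass below 7, so they overlap in more than 5.
  obtain ⟨u, huK, i, hu⟩ : ∃ u ∈ K.classB j, ∃ i, K₀.IsB i u := by
    by_contra! hcon
    have hsub : K.classB j ⊆ ({v | K₀.IsStray v} : Finset V) := by
      intro u hu
      have hh := (mem_classB.1 hu).isHeavy hD
      simp only [mem_filter, mem_univ, true_and]
      exact ⟨fun h => h.not_isHeavy hD hh, fun h => h.not_isHeavy hD hh, hcon u hu⟩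
    have h1 := K₀.stray_lt_one hD
    have h2 : (#(K.classB j) : ℝ) ≤ #{v | K₀.IsStray v} := by exact_mod_cast card_le_card hsub
    have := mul_le_mul_of_nonneg_left h2 hD.pos.le
    linarith
  refine ⟨i, ?_⟩
  have h := hD.green_sdiff_lt (z := u) (S := K₀.classB i) (T := K.classB j)
    (fun x hx => hu.w_eq_zero (mem_classB.1 hx) hG)
    (fun x hx => (mem_classB.1 huK).w_eq_zero (mem_classB.1 hx) hG) (K₀.six_lt_classB hD i)
  have hsub : K.classB j ∩ K₀.classB i ⊆ G.green (K.b j) ∩ K₀.classB i :=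
    inter_subset_inter_right fun x hx =>
      mem_green.2 ((K.isB_b j).w_eq_zero (mem_classB.1 hx) hG)
  have h2 : (#(K.classB j ∩ K₀.classB i) : ℝ) ≤ #(G.green (K.b j) ∩ K₀.classB i) := by
    exact_mod_cast card_le_card hsub
  have := mul_le_mul_of_nonneg_left h2 hD.pos.le
  linarith

-- Suppose vv' is not green and take a frame with `b j = v` that is score-maximal for v'. If v' is
-- green to an end of the blue edge, it is green to that a-class as well as to its share of
-- `K₀.classB i`, and 2(10/3 + 5) > 14. If it is green to `b k` with k ≠ j, then two disjoint
-- classes each take more than 4 from `K₀.classB i`, whose mass is below 7.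
open Classical in
theorem green_of_label (hD : G.IsDense (Fintype.card ι) c) (K₀ : Frame G ι) {v v' : V} {i : ι}
    (hvh : G.IsHeavy c v)
    (hv : 5 < c * #(G.green v ∩ K₀.classB i)) (hv' : 5 < c * #(G.green v' ∩ K₀.classB i)) :
    G.w v' v = 0 := by
  have hG := hD.cliqueBound
  obtain ⟨K₁, j, rfl⟩ := exists_b_eq hD K₀ hvh
  by_contra hne
  obtain ⟨K, hKj, hK⟩ := exists_max_score (P := fun K : Frame G ι => K.b j = K₁.b j)
    ⟨K₁, rfl⟩ v'
  rw [← hKj] at hv hne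
  have hlight : ∀ K' : Frame G ι, (∀ u ∈ K'.classA, G.w v' u = 0) → False := by
    intro K' h
    have := hD.two_sets v' (S := K'.classA) (T := G.green v' ∩ K₀.classB i)
      ((disjoint_of_heavy hD K' K₀ i).mono_right inter_subset_right) (p := 2) (q := 2)
      (fun u hu => (gap_eq_two (h u hu)).ge)
      (fun u hu => (gap_eq_two (mem_green.1 (mem_inter.1 hu).1)).ge)
    have := K'.ten_lt_classA hD
    linarith
  rcases K.exists_green hG v' with h | h | ⟨k, h⟩
  · refine hlight K fun u hu => ?_
    have := w_le_of_score_setA (hu := (mem_classA.1 hu).2.1) (hb := (mem_classA.1 hu).2.2)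
      (hK _ hKj)
    omega
  · refine hlight K.flip fun u hu => ?_
    have : G.w v' u ≤ G.w v' K.a₂ := w_le_of_score_setA (K := K.flip)
      (hu := (mem_classA.1 hu).2.1) (hb := (mem_classA.1 hu).2.2)
      (by rw [flip_score]; exact hK _ hKj)
    omega
  · have hkj : k ≠ j := by rintro rfl; exact hne h
    have hgreen : ∀ u ∈ K.classB k, G.w v' u = 0 := fun u hu => by
      have := w_le_of_score_setB (hu := mem_classB.1 hu)
        (hK _ (by simpa [setB, Function.update_of_ne hkj.symm] using hKj))
      omega
    have h1 := hD.green_sdiff_lt hgreen (T := G.green v' ∩ K₀.classB i)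
      (fun u hu => mem_green.1 (mem_inter.1 hu).1) (K.six_lt_classB hD k)
    have h2 := hD.green_sdiff_lt
      (fun u hu => (K.isB_b j).w_eq_zero (mem_classB.1 hu) hG) (T := G.green (K.b j) ∩ K₀.classB i)
      (fun u hu => mem_green.1 (mem_inter.1 hu).1) (K.six_lt_classB hD j)
    have hdis : Disjoint (G.green v' ∩ K₀.classB i ∩ K.classB k)
        (G.green (K.b j) ∩ K₀.classB i ∩ K.classB j) :=
      (K.disjoint_classB hG hkj).mono inter_subset_right inter_subset_right
    have h3 : #(G.green v' ∩ K₀.classB i ∩ K.classB k)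
        + #(G.green (K.b j) ∩ K₀.classB i ∩ K.classB j) ≤ #(K₀.classB i) := by
      rw [← card_union_of_disjoint hdis]
      refine card_le_card (union_subset ?_ ?_) <;>
        exact inter_subset_left.trans inter_subset_right
    have h4 : (#(G.green v' ∩ K₀.classB i ∩ K.classB k) : ℝ)
        + #(G.green (K.b j) ∩ K₀.classB i ∩ K.classB j) ≤ #(K₀.classB i) := by exact_mod_cast h3
    have h5 := mul_le_mul_of_nonneg_left h4 hD.pos.le
    have h6 := hD.green_lt (z := K₀.b i) (S := K₀.classB i)
      (fun u hu => (K₀.isB_b i).w_eq_zero (mem_classB.1 hu) hG)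
    linarith

/-- The light vertices can be split into two green sets. -/
theorem exists_light_colouring (hD : G.IsDense (Fintype.card ι) c) (K₀ : Frame G ι)
    {f : V → ι} (hf : ∀ x y, G.IsHeavy c x → G.IsHeavy c y → f x = f y → G.w x y = 0) :
    ∃ g : V → Bool, ∀ x y, ¬ G.IsHeavy c x → ¬ G.IsHeavy c y → g x = g y → G.w x y = 0 := by
  classical
  let A : Finset V := {v | ¬ G.IsHeavy c v}
  have hmemA : ∀ v, v ∈ A ↔ ¬ G.IsHeavy c v := fun v => by simp [A]
  -- The heavy vertices form m green sets, each of mass at most 7.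
  have hA : 9 ≤ c * #A := by
    have h1 : #{v | G.IsHeavy c v} + #A = Fintype.card V :=
      card_filter_add_card_filter_not (s := univ) _
    have h2 : #{v | G.IsHeavy c v} = ∑ i, #{v ∈ ({v | G.IsHeavy c v} : Finset V) | f v = i} :=
      card_eq_sum_card_fiberwise fun _ _ => mem_univ _
    have h3 : ∀ i, c * (#{v ∈ ({v | G.IsHeavy c v} : Finset V) | f v = i} : ℝ) ≤ 7 := by
      intro i
      rcases ({v ∈ ({v | G.IsHeavy c v} : Finset V) | f v = i} : Finset V).eq_empty_or_nonempty
        with he | ⟨z, hz⟩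
      · rw [he]; simp
      · refine (hD.green_lt (z := z) fun u hu => ?_).le
        simp only [mem_filter, mem_univ, true_and] at hz hu
        exact hf z u hz.1 hu.1 (hz.2.trans hu.2.symm)
    have h4 : c * (#{v | G.IsHeavy c v} : ℝ) ≤ 7 * Fintype.card ι := by
      rw [h2]
      push_cast
      rw [mul_sum]
      calc _ ≤ ∑ _i : ι, (7 : ℝ) := sum_le_sum fun i _ => h3 i
        _ = _ := by simp [mul_comm]
    have h5 : (#{v | G.IsHeavy c v} : ℝ) + #A = Fintype.card V := by exact_mod_cast h1
    have h6 := hD.total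
    rw [← h5] at h6
    linarith
  let H : SimpleGraph A :=
    { Adj := fun x y => G.w x y ≠ 0
      symm := ⟨fun x y h => by rwa [G.symm]⟩
      loopless := ⟨fun x h => h (G.loopless _)⟩ }
  have hfree : H.CliqueFree (2 + 1) := by
    intro s hs
    obtain ⟨x, y, z, hxy, hxz, hyz, -⟩ := SimpleGraph.is3Clique_iff.1 hs
    exact light_no_triangle hD K₀ ((hmemA _).1 z.2) ((hmemA _).1 y.2) ((hmemA _).1 x.2)
      hyz hxz hxy
  -- Without red edges, the gap of x inside `A` is 2|A| minus its degree in `H`. Its mass is below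
  -- 14, which is at most 14/9 of the mass of `A`.
  have hdeg : ∀ x : A, 4 * #A < 9 * H.degree x := by
    intro x
    have h1 : ∑ z ∈ A, (2 - (G.w x z : ℝ)) ≤ ∑ z, (2 - (G.w x z : ℝ)) :=
      sum_le_sum_of_subset_of_nonneg (subset_univ _) fun u _ _ => ColouredGraph.gap_nonneg G _ u
    have h2 : ∑ z ∈ A, (G.w x z : ℝ) ≤ H.degree x := by
      have hd : H.degree x = #{z ∈ A | G.w x z ≠ 0} := by
        rw [← SimpleGraph.card_neighborFinset_eq_degree,
          ← card_map (Function.Embedding.subtype _)]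
        congr 1
        ext z
        simp only [mem_map, SimpleGraph.mem_neighborFinset, Function.Embedding.subtype_apply,
          mem_filter]
        constructor
        · rintro ⟨y, hy, rfl⟩; exact ⟨y.2, hy⟩
        · rintro ⟨hz, h⟩; exact ⟨⟨z, hz⟩, h, rfl⟩
      rw [hd, card_filter]
      push_cast
      refine sum_le_sum fun z hz => ?_
      have hle := G.le_two x z
      have hne := light_not_red hD K₀ ((hmemA _).1 hz) ((hmemA _).1 x.2)
      split_ifs with h
      · exact_mod_cast (by omega : G.w x z ≤ 1)
      · exact_mod_cast (by omega : G.w x z ≤ 0)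
    rw [sum_sub_distrib, sum_const, nsmul_eq_mul] at h1
    have h3 := hD.deficit_lt x
    have h4 : (#A : ℝ) * 2 - H.degree x ≤ ∑ z, (2 - (G.w x z : ℝ)) := by linarith
    have h5 := mul_le_mul_of_nonneg_left h4 hD.pos.le
    have h6 : 0 < c * (9 * H.degree x - 4 * #A : ℝ) := by linarith
    have h7 : (0 : ℝ) < 9 * H.degree x - 4 * #A := pos_of_mul_pos_right h6 hD.pos.le
    exact_mod_cast (by linarith : (4 : ℝ) * #A < 9 * H.degree x)
  have hne : A.Nonempty := by
    rw [nonempty_iff_ne_empty]; intro h; rw [h] at hA; norm_num at hA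
  have : Nonempty A := hne.to_subtype
  have hcol : H.Colorable 2 := by
    -- The Andrásfai–Erdős–Sós theorem for triangles, with threshold 2/5 < 4/9.
    refine SimpleGraph.colorable_of_cliqueFree_lt_minDegree hfree ?_
    obtain ⟨x, hx⟩ := H.exists_minimal_degree_vertex
    have := hdeg x
    rw [hx, Fintype.card_coe]
    omega
  obtain ⟨col⟩ := hcol
  refine ⟨fun v => if h : v ∈ A then decide (col ⟨v, h⟩ = 0) else false, fun x y hx hy hg => ?_⟩
  by_contra hxy
  have hx' := (hmemA x).2 hx
  have hy' := (hmemA y).2 hy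
  have hv : col ⟨x, hx'⟩ ≠ col ⟨y, hy'⟩ := col.valid hxy
  simp only [hx', hy', dite_true, decide_eq_decide] at hg
  omega

theorem exists_colouring [Nonempty ι] (hD : G.IsDense (Fintype.card ι) c) (K₀ : Frame G ι) :
    ∃ φ : V → Bool ⊕ ι, ∀ x y,
      (φ x = φ y → G.w x y = 0) ∧ ((φ x).isLeft → (φ y).isLeft → G.w x y ≠ 2) := by
  classical
  have hlab : ∀ v, ∃ i, G.IsHeavy c v → 5 < c * #(G.green v ∩ K₀.classB i) := by
    intro v
    by_cases h : G.IsHeavy c v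
    · obtain ⟨i, hi⟩ := exists_label hD K₀ h
      exact ⟨i, fun _ => hi⟩
    · exact ⟨Classical.arbitrary ι, fun h' => absurd h' h⟩
  choose f hf using hlab
  have hff : ∀ x y, G.IsHeavy c x → G.IsHeavy c y → f x = f y → G.w x y = 0 := by
    intro x y hx hy hxy
    exact green_of_label hD K₀ hy (hf y hy) (hxy ▸ hf x hx)
  obtain ⟨g, hg⟩ := exists_light_colouring hD K₀ hff
  refine ⟨fun v => if G.IsHeavy c v then Sum.inr (f v) else Sum.inl (g v), fun x y => ?_⟩
  by_cases hx : G.IsHeavy c x <;> by_cases hy : G.IsHeavy c y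
  · simpa [hx, hy] using hff x y hx hy
  · simp [hx, hy]
  · simp [hx, hy]
  · simpa [hx, hy] using ⟨hg x y hx hy, light_not_red hD K₀ hy hx⟩

end Frame

end ColouredGraph

/-! ### From a balanced green-free clique to a frame -/

namespace ColouredGraph

variable {V : Type*}

/-- `S` is a red clique of maximum size among the subsets of `K`. -/
structure IsMaxRed (G : ColouredGraph V) (K S : Finset V) : Prop where
  subset : S ⊆ K
  red : ∀ x ∈ S, ∀ y ∈ S, x ≠ y → G.w x y = 2
  max : ∀ S' ⊆ K, (∀ x ∈ S', ∀ y ∈ S', x ≠ y → G.w x y = 2) → #S' ≤ #S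

theorem exists_isMaxRed (G : ColouredGraph V) (K : Finset V) : ∃ S, G.IsMaxRed K S := by
  classical
  obtain ⟨S, hS, hmax⟩ := exists_max_image
    {S ∈ K.powerset | ∀ x ∈ S, ∀ y ∈ S, x ≠ y → G.w x y = 2} card ⟨∅, by simp⟩
  simp only [mem_filter, mem_powerset] at hS hmax
  exact ⟨S, hS.1, hS.2, fun S' h1 h2 => hmax S' ⟨h1, h2⟩⟩

/-- A positive weighting `q` of a clique `K` without green edges, for which every vertex of `K` has
weighted deficit `1` and whose total weight exceeds `m / 2 + 9 / 14`. -/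
structure IsBalanced (G : ColouredGraph V) (m : ℕ) (K : Finset V) (q : V → ℝ) : Prop where
  pos : ∀ x ∈ K, 0 < q x
  ne_zero : ∀ x ∈ K, ∀ y ∈ K, x ≠ y → G.w x y ≠ 0
  deficit : ∀ x ∈ K, ∑ y ∈ K, (2 - (G.w x y : ℝ)) * q y = 1
  total : (m : ℝ) / 2 + 9 / 14 < ∑ x ∈ K, q x

namespace IsBalanced

variable {G : ColouredGraph V} {m : ℕ} {K S : Finset V} {q : V → ℝ}

theorem two_mul_add_le (h : G.IsBalanced m K q) {x y : V} (hx : x ∈ K) (hy : y ∈ K)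
    (hxy : x ≠ y) : 2 * q x + (2 - (G.w x y : ℝ)) * q y ≤ 1 := by
  rw [← h.deficit x hx]
  have := add_le_sum (f := fun y => (2 - (G.w x y : ℝ)) * q y) (s := K)
    (fun z hz => mul_nonneg (gap_nonneg G x z) (h.pos z hz).le) hx hy hxy
  simpa [G.loopless] using this

theorem two_mul_le (h : G.IsBalanced m K q) {x : V} (hx : x ∈ K) : 2 * q x ≤ 1 := by
  rw [← h.deficit x hx]
  have := single_le_sum (f := fun y => (2 - (G.w x y : ℝ)) * q y) (s := K)
    (fun z hz => mul_nonneg (gap_nonneg G x z) (h.pos z hz).le) hx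
  simpa [G.loopless] using this

theorem nonempty (h : G.IsBalanced m K q) : K.Nonempty := by
  rw [nonempty_iff_ne_empty]
  rintro rfl
  have := h.total
  rw [sum_empty] at this
  have : (0 : ℝ) ≤ m := Nat.cast_nonneg m
  linarith

theorem maxRed_nonempty (h : G.IsBalanced m K q) (hS : G.IsMaxRed K S) : S.Nonempty := by
  obtain ⟨x, hx⟩ := h.nonempty
  have := hS.max {x} (by simpa using hx) (by simp)
  rw [card_singleton] at this
  exact card_pos.1 (by omega)

theorem card_le (h : G.IsBalanced m K q) (hG : G.CliqueBound (2 * m + 4))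
    (hS : G.IsMaxRed K S) : #K + #S < 2 * m + 4 :=
  hG K S hS.subset (h.maxRed_nonempty hS) h.ne_zero hS.red

variable [DecidableEq V]

/-- Sum the balance equations over `S`; inside a red clique only the diagonal gap 2 survives. -/
theorem card_eq (h : G.IsBalanced m K q) (hS : G.IsMaxRed K S) :
    (#S : ℝ) = 2 * ∑ s ∈ S, q s + ∑ t ∈ K \ S, (∑ s ∈ S, (2 - (G.w t s : ℝ))) * q t := by
  have h1 : ∀ s ∈ S, 2 * q s + ∑ t ∈ K \ S, (2 - (G.w t s : ℝ)) * q t = 1 := by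
    intro s hs
    rw [← h.deficit s (hS.subset hs), ← sum_sdiff hS.subset, add_comm]
    congr 1
    · exact sum_congr rfl fun t _ => by rw [G.symm]
    · rw [sum_eq_single_of_mem s hs]
      · simp [G.loopless]
      · intro y hy hys
        rw [hS.red s hs y hy hys.symm]
        norm_num
  have h2 : ∑ s ∈ S, (2 * q s + ∑ t ∈ K \ S, (2 - (G.w t s : ℝ)) * q t) = #S := by
    rw [sum_congr rfl h1]; simp
  rw [← h2, sum_add_distrib, ← mul_sum, sum_comm]
  simp only [sum_mul]

theorem exists_blue (hS : G.IsMaxRed K S) {t : V} (ht : t ∈ K \ S) : ∃ s ∈ S, G.w t s ≠ 2 := by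
  by_contra! hcon
  obtain ⟨htK, htS⟩ := mem_sdiff.1 ht
  have := hS.max (insert t S) (insert_subset htK hS.subset) (by
    intro x hx y hy hxy
    rcases mem_insert.1 hx with hx' | hx' <;> rcases mem_insert.1 hy with hy' | hy'
    · exact absurd (hx'.trans hy'.symm) hxy
    · rw [hx']; exact hcon y hy'
    · rw [hy', G.symm]; exact hcon x hx'
    · exact hS.red x hx' y hy' hxy)
  rw [card_insert_of_notMem htS] at this
  omega

/-- The amount by which `t` contributes to the gap between `#K + #S` and four times the total
weight. -/
noncomputable def loss (G : ColouredGraph V) (S : Finset V) (q : V → ℝ) (t : V) : ℝ :=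
  1 / 4 - q t + (∑ s ∈ S, (2 - (G.w t s : ℝ))) * q t / 2

theorem loss_ge (h : G.IsBalanced m K q) (hS : G.IsMaxRed K S) {t : V} (ht : t ∈ K \ S) :
    1 / 4 - q t / 2 ≤ loss G S q t := by
  obtain ⟨s, hs, hts⟩ := exists_blue hS ht
  have h1 := one_le_gap hts
  have h2 := single_le_sum (f := fun s => 2 - (G.w t s : ℝ)) (s := S)
    (fun z _ => gap_nonneg G t z) hs
  have h3 := h.pos t (mem_sdiff.1 ht).1
  have h4 : 1 * q t ≤ (∑ s ∈ S, (2 - (G.w t s : ℝ))) * q t :=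
    mul_le_mul_of_nonneg_right (h1.trans h2) h3.le
  unfold loss
  linarith

theorem loss_nonneg (h : G.IsBalanced m K q) (hS : G.IsMaxRed K S) {t : V} (ht : t ∈ K \ S) :
    0 ≤ loss G S q t := by
  have := h.loss_ge hS ht
  have := h.two_mul_le (mem_sdiff.1 ht).1
  linarith

/-- By `card_eq` the losses add up to (|K| + |S|)/4 minus the total weight, which is less than (2m +
3)/4 - m/2 - 9/14 = 3/28. -/
theorem sum_loss_lt (h : G.IsBalanced m K q) (hG : G.CliqueBound (2 * m + 4))
    (hS : G.IsMaxRed K S) : ∑ t ∈ K \ S, loss G S q t < 3 / 28 := by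
  have h1 := h.card_eq hS
  have h2 := h.total
  rw [← sum_sdiff hS.subset] at h2
  have h3 := h.card_le hG hS
  have h4 := card_sdiff_add_card_eq_card hS.subset
  have h5 : (2 : ℝ) * #S + #(K \ S) ≤ 2 * m + 3 := by exact_mod_cast (by omega)
  simp only [loss]
  rw [sum_add_distrib, sum_sub_distrib, sum_const, nsmul_eq_mul, ← sum_div]
  linarith

theorem loss_lt (h : G.IsBalanced m K q) (hG : G.CliqueBound (2 * m + 4))
    (hS : G.IsMaxRed K S) {t : V} (ht : t ∈ K \ S) : loss G S q t < 3 / 28 :=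
  (single_le_sum (fun _ hz => h.loss_nonneg hS hz) ht).trans_lt (h.sum_loss_lt hG hS)

theorem two_sevenths_lt (h : G.IsBalanced m K q) (hG : G.CliqueBound (2 * m + 4))
    (hS : G.IsMaxRed K S) {t : V} (ht : t ∈ K \ S) : 2 / 7 < q t := by
  have := h.loss_lt hG hS ht
  have := h.loss_ge hS ht
  linarith

theorem exists_unique_blue (h : G.IsBalanced m K q) (hG : G.CliqueBound (2 * m + 4))
    (hS : G.IsMaxRed K S) {t : V} (ht : t ∈ K \ S) :
    ∃ s ∈ S, G.w t s = 1 ∧ ∀ s' ∈ S, s' ≠ s → G.w t s' = 2 := by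
  obtain ⟨s, hs, hts⟩ := exists_blue hS ht
  obtain ⟨htK, htS⟩ := mem_sdiff.1 ht
  have hne : t ≠ s := fun e => htS (e ▸ hs)
  have h0 := h.ne_zero t htK s (hS.subset hs) hne
  have hle := G.le_two t s
  refine ⟨s, hs, by omega, fun s' hs' hss => ?_⟩
  by_contra hts'
  have h1 := one_le_gap hts
  have h1' := one_le_gap hts'
  have h2 := add_le_sum (f := fun s => 2 - (G.w t s : ℝ)) (s := S)
    (fun z _ => gap_nonneg G t z) hs' hs hss
  have h3 := h.pos t htK
  have h4 : 2 * q t ≤ (∑ s ∈ S, (2 - (G.w t s : ℝ))) * q t :=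
    mul_le_mul_of_nonneg_right (by linarith) h3.le
  have h5 := h.loss_lt hG hS ht
  unfold loss at h5
  linarith

/-- Exchanging t with its only blue neighbour s in `S` gives another maximum red clique, so q s >
2/7 as well; the balance at t then bounds q t. -/
theorem le_of_mem_sdiff (h : G.IsBalanced m K q) (hG : G.CliqueBound (2 * m + 4))
    (hS : G.IsMaxRed K S) {t : V} (ht : t ∈ K \ S) : q t ≤ 5 / 14 := by
  obtain ⟨s, hs, hts, hred⟩ := h.exists_unique_blue hG hS ht
  obtain ⟨htK, htS⟩ := mem_sdiff.1 ht
  have hne : t ≠ s := fun e => htS (e ▸ hs)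
  have hS' : G.IsMaxRed K (insert t (S.erase s)) := by
    refine ⟨insert_subset htK ((erase_subset _ _).trans hS.subset), ?_, fun S' h1 h2 => ?_⟩
    · intro x hx y hy hxy
      rcases mem_insert.1 hx with hx' | hx' <;> rcases mem_insert.1 hy with hy' | hy'
      · exact absurd (hx'.trans hy'.symm) hxy
      · rw [hx']; exact hred y (mem_of_mem_erase hy') (ne_of_mem_erase hy')
      · rw [hy', G.symm]; exact hred x (mem_of_mem_erase hx') (ne_of_mem_erase hx')
      · exact hS.red x (mem_of_mem_erase hx') y (mem_of_mem_erase hy') hxy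
    · rw [card_insert_of_notMem (fun h => htS (mem_of_mem_erase h)), card_erase_of_mem hs]
      have := hS.max S' h1 h2
      omega
  have hs' : s ∈ K \ insert t (S.erase s) := by
    simp [hS.subset hs, hne.symm]
  have h1 := h.two_sevenths_lt hG hS' hs'
  have h2 := h.two_mul_add_le htK (hS.subset hs) hne
  rw [hts] at h2
  norm_num at h2
  linarith

theorem nonempty_frame (h : G.IsBalanced m K q) (hG : G.CliqueBound (2 * m + 4)) :
    Nonempty (Frame G (Fin m)) := by
  obtain ⟨S, hS⟩ := G.exists_isMaxRed K
  have hcard := h.card_le hG hS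
  have hcard' := card_sdiff_add_card_eq_card hS.subset
  -- Each vertex outside `S` loses at least 1/4 - 5/28 = 2/28, so two of them would exceed 3/28.
  have hT : #(K \ S) ≤ 1 := by
    by_contra! hlt
    obtain ⟨t, ht, t', ht', hne⟩ := one_lt_card.1 hlt
    have h1 := add_le_sum (fun _ hz => h.loss_nonneg hS hz) ht ht' hne
    have h2 := h.sum_loss_lt hG hS
    have h3 := h.loss_ge hS ht
    have h4 := h.loss_ge hS ht'
    have h5 := h.le_of_mem_sdiff hG hS ht
    have h6 := h.le_of_mem_sdiff hG hS ht'
    linarith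
  have heq := h.card_eq hS
  have htot := h.total
  rw [← sum_sdiff hS.subset] at htot
  rcases Nat.lt_or_ge #(K \ S) 1 with hlt | hge
  · have he : K \ S = ∅ := card_eq_zero.1 (by omega)
    rw [he, sum_empty] at heq htot
    have : (#S : ℝ) ≤ m + 1 := by exact_mod_cast (by rw [he, card_empty] at hcard'; omega)
    linarith
  obtain ⟨t, ht⟩ := card_eq_one.1 (le_antisymm hT hge)
  have htm : t ∈ K \ S := by rw [ht]; exact mem_singleton_self t
  obtain ⟨s, hs, hts, hred⟩ := h.exists_unique_blue hG hS htm
  have h1 := h.sum_loss_lt hG hS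
  have h2 := h.loss_nonneg hS htm
  have h3 := h.two_mul_le (mem_sdiff.1 htm).1
  have h4 := h.loss_ge hS htm
  rw [ht, sum_singleton] at heq htot h1
  unfold loss at h4
  have h5 : (m : ℝ) < #S := by linarith
  have h6 : m < #S := by exact_mod_cast h5
  have h7 : #(S.erase s) = m := by
    rw [card_erase_of_mem hs]
    rw [ht, card_singleton] at hcard'
    omega
  let e := (S.erase s).equivFinOfCardEq h7
  have he : ∀ i, (e.symm i : V) ∈ S ∧ (e.symm i : V) ≠ s := fun i =>
    ⟨mem_of_mem_erase (e.symm i).2, ne_of_mem_erase (e.symm i).2⟩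
  exact ⟨⟨t, s, fun i => e.symm i, hts, fun i => hred _ (he i).1 (he i).2,
    fun i => hS.red _ hs _ (he i).1 (he i).2.symm,
    fun i j hij => hS.red _ (he i).1 _ (he j).1
      fun h => hij (e.symm.injective (Subtype.ext h))⟩⟩

end IsBalanced

/-! ### Minimising the gap form on the simplex -/

section Lagrangian

open Matrix

/-- The matrix of missing weights. -/
def gapMatrix (G : ColouredGraph V) : Matrix V V ℝ := of fun x y => 2 - (G.w x y : ℝ)

theorem gapMatrix_apply (G : ColouredGraph V) (x y : V) :
    G.gapMatrix x y = 2 - (G.w x y : ℝ) := rfl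

theorem gapMatrix_transpose (G : ColouredGraph V) : G.gapMatrixᵀ = G.gapMatrix := by
  ext x y
  simp [gapMatrix_apply, G.symm x y]

variable [Fintype V]

/-- The second-order coefficient is 2 + 2 - 2(2 - w(x,y)) = 2w(x,y). It vanishes on green edges, so
that weight can be moved along them at no cost. -/
theorem quadratic_shift [DecidableEq V] (G : ColouredGraph V) (p : V → ℝ) (x y : V) (t : ℝ) :
    (p + t • (Pi.single x 1 - Pi.single y 1)) ⬝ᵥ
        (G.gapMatrix *ᵥ (p + t • (Pi.single x 1 - Pi.single y 1))) =
      p ⬝ᵥ (G.gapMatrix *ᵥ p) + 2 * t * ((G.gapMatrix *ᵥ p) x - (G.gapMatrix *ᵥ p) y)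
        + 2 * t ^ 2 * G.w x y := by
  have hsym : ∀ u v : V → ℝ, u ⬝ᵥ (G.gapMatrix *ᵥ v) = v ⬝ᵥ (G.gapMatrix *ᵥ u) := by
    intro u v
    rw [dotProduct_mulVec, ← mulVec_transpose, gapMatrix_transpose, dotProduct_comm]
  rw [mulVec_add, dotProduct_add, add_dotProduct, add_dotProduct,
    hsym p (t • _), mulVec_smul]
  simp only [smul_dotProduct, dotProduct_smul, sub_dotProduct, single_dotProduct, mulVec_sub,
    Pi.sub_apply, mulVec_single, smul_eq_mul, one_mul, col_apply,
    MulOpposite.op_one, one_smul, gapMatrix_apply, G.loopless, G.symm y x]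
  push_cast
  ring

theorem exists_isBalanced [Nonempty V] (G : ColouredGraph V) {m : ℕ} {c : ℝ}
    (hD : G.IsDense m c) : ∃ K q, G.IsBalanced m K q := by
  classical
  let Φ : (V → ℝ) → ℝ := fun p => p ⬝ᵥ (G.gapMatrix *ᵥ p)
  have hcont : Continuous Φ := by
    refine Continuous.dotProduct continuous_id ?_
    exact Continuous.matrix_mulVec continuous_const continuous_id
  have hne : (stdSimplex ℝ V).Nonempty := ⟨_, single_mem_stdSimplex ℝ (Classical.arbitrary V)⟩
  obtain ⟨p₀, hp₀, hmin₀⟩ := (isCompact_stdSimplex ℝ V).exists_isMinOn hne hcont.continuousOn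
  obtain ⟨p, ⟨hp, hmin⟩, hsupp⟩ :=
    (measure fun p : V → ℝ => #{x | p x ≠ 0}).wf.has_min
      {p | p ∈ stdSimplex ℝ V ∧ ∀ p' ∈ stdSimplex ℝ V, Φ p ≤ Φ p'} ⟨p₀, hp₀, fun p' hp' => hmin₀ hp'⟩
  have hshift : ∀ x y t, x ≠ y → -p x ≤ t → t ≤ p y →
      p + t • (Pi.single x 1 - Pi.single y 1) ∈ stdSimplex ℝ V := by
    intro x y t hxy hx hy
    refine ⟨fun z => ?_, ?_⟩
    · by_cases hzx : z = x
      · subst hzx; simp [hxy]; linarith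
      · by_cases hzy : z = y
        · subst hzy; simp [hzx]; linarith
        · simpa [hzx, hzy] using hp.1 z
    · have := hp.2
      simp [sum_add_distrib, ← mul_sum, this]
  have hle : ∀ x y, 0 < p x → 0 < p y → (G.gapMatrix *ᵥ p) x ≤ (G.gapMatrix *ᵥ p) y := by
    intro x y hx hy
    by_contra! hlt
    have hxy : x ≠ y := by rintro rfl; exact lt_irrefl _ hlt
    set δ := (G.gapMatrix *ᵥ p) x - (G.gapMatrix *ᵥ p) y with hδ
    have hδ0 : 0 < δ := by linarith
    -- The change under this shift is at most -2sδ + 4s², which is negative for s ≤ δ/4.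
    set s := min (p x) (δ / 4) with hs
    have hs0 : 0 < s := lt_min hx (by linarith)
    have h1 := hmin _ (hshift x y (-s) hxy (by linarith [min_le_left (p x) (δ / 4)]) (by linarith))
    simp only [Φ, quadratic_shift] at h1
    have h2 : (G.w x y : ℝ) ≤ 2 := by exact_mod_cast G.le_two x y
    have h3 : s ≤ δ / 4 := min_le_right _ _
    nlinarith
  have heq : ∀ x y, 0 < p x → 0 < p y → (G.gapMatrix *ᵥ p) x = (G.gapMatrix *ᵥ p) y :=
    fun x y hx hy => le_antisymm (hle x y hx hy) (hle y x hy hx)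
  let K : Finset V := {x | p x ≠ 0}
  have hK : ∀ x, x ∈ K ↔ 0 < p x := fun x => by
    simp only [K, mem_filter, mem_univ, true_and]
    exact ⟨fun h => lt_of_le_of_ne (hp.1 x) h.symm, fun h => h.ne'⟩
  have hsumK : ∑ x ∈ K, p x = 1 := by
    rw [← hp.2, sum_filter_ne_zero]
  have hKne : K.Nonempty := by
    rw [nonempty_iff_ne_empty]; intro h; rw [h] at hsumK; norm_num at hsumK
  obtain ⟨k, hk⟩ := hKne
  have hΦ : Φ p = (G.gapMatrix *ᵥ p) k := by
    have h1 : ∀ x, p x * (G.gapMatrix *ᵥ p) x = p x * (G.gapMatrix *ᵥ p) k := by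
      intro x
      rcases (hp.1 x).lt_or_eq with h | h
      · rw [heq x k h ((hK k).1 hk)]
      · rw [← h, zero_mul, zero_mul]
    simp only [Φ, dotProduct, h1]
    rw [← sum_mul, hp.2, one_mul]
  have hmulVec : ∀ x, (G.gapMatrix *ᵥ p) x = ∑ y ∈ K, (2 - (G.w x y : ℝ)) * p y := by
    intro x
    rw [mulVec, dotProduct]
    symm
    refine sum_subset (subset_univ _) fun y _ hy => ?_
    have : p y = 0 := by simpa [K] using hy
    rw [this, mul_zero]
  have hpos : 0 < Φ p := by
    rw [hΦ, hmulVec]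
    have h1 := single_le_sum (f := fun y => (2 - (G.w k y : ℝ)) * p y) (s := K)
      (fun z _ => mul_nonneg (gap_nonneg G k z) (hp.1 z)) hk
    have h2 := (hK k).1 hk
    simp only [G.loopless] at h1
    push_cast at h1
    linarith
  have hcard : (0 : ℝ) < Fintype.card V := by exact_mod_cast Fintype.card_pos
  -- The competitor is the uniform distribution, whose value is governed by the average gap.
  have hΦlt : Φ p * (7 * m + 9) < 14 := by
    have hu : (fun _ : V => (Fintype.card V : ℝ)⁻¹) ∈ stdSimplex ℝ V :=
      ⟨fun _ => (inv_pos.2 hcard).le, by simp [hcard.ne']⟩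
    have h1 := hmin _ hu
    have h2 : Φ (fun _ : V => (Fintype.card V : ℝ)⁻¹) * (7 * m + 9)
        = (Fintype.card V : ℝ)⁻¹ * ∑ x, c * ∑ z, (2 - (G.w x z : ℝ)) := by
      simp only [Φ, dotProduct, mulVec, gapMatrix_apply, ← sum_mul, ← mul_sum, ← hD.total]
      field_simp
    have h3 : ∑ x, c * ∑ z, (2 - (G.w x z : ℝ)) < ∑ _x : V, (14 : ℝ) :=
      sum_lt_sum_of_nonempty univ_nonempty fun x _ => hD.deficit_lt x
    have h4 : (Fintype.card V : ℝ)⁻¹ * ∑ x, c * ∑ z, (2 - (G.w x z : ℝ)) < 14 := by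
      rw [inv_mul_lt_iff₀ hcard]
      simpa using h3
    have h5 : (0 : ℝ) ≤ 7 * m + 9 := by positivity
    nlinarith
  refine ⟨K, fun x => p x / Φ p, fun x hx => div_pos ((hK x).1 hx) hpos, ?_, ?_, ?_⟩
  · intro x hx y hy hxy h0
    have hx' := (hK x).1 hx
    have hy' := (hK y).1 hy
    -- Moving all weight of y across a green edge keeps the minimum and shrinks the support.
    set p' := p + p y • (Pi.single x 1 - Pi.single y 1) with hp'
    have h1 : Φ p' = Φ p := by
      simp only [Φ, hp', quadratic_shift, h0, heq x y hx' hy']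
      simp
    refine hsupp p' ⟨hshift x y _ hxy (by linarith) le_rfl, fun r hr => h1 ▸ hmin r hr⟩ ?_
    refine card_lt_card ⟨fun z hz => ?_, fun h => ?_⟩
    · simp only [mem_filter, mem_univ, true_and] at hz ⊢
      intro hz0
      have hzx : z ≠ x := by rintro rfl; linarith
      have hzy : z ≠ y := by rintro rfl; linarith
      exact hz (by simp [hp', hzx, hzy, hz0])
    · have := h hy
      simp [hp', hxy.symm] at this
  · intro x hx
    simp only [mul_div_assoc']
    rw [← sum_div, ← hmulVec, heq x k ((hK x).1 hx) ((hK k).1 hk), ← hΦ, div_self hpos.ne']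
  · rw [← sum_div, hsumK, lt_div_iff₀ hpos]
    linarith

end Lagrangian

end ColouredGraph

namespace ColouredGraph

/-! ### Homomorphisms as partitions -/

section Partition

variable {V : Type*}

theorem redCliqueMinus_w_self {r : ℕ} (i : Fin r) : (redCliqueMinus r).w i i = 0 :=
  (redCliqueMinus r).loopless i

theorem hasHom_iff_exists_partition (G : ColouredGraph V) (r : ℕ) :
    G.HasHom (redCliqueMinus r) ↔ ∃ W : Fin r → Set V, G.IsMinusPartition W := by
  constructor
  · rintro ⟨φ, hφ⟩
    refine ⟨fun i => {v | φ v = i}, ?_, ?_, ?_, ?_⟩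
    · intro i j hij
      rw [Set.disjoint_left]
      intro v hi hj
      exact hij (Eq.trans (Eq.symm hi) hj)
    · ext v; simp
    · intro i x hx y hy hxy
      have h := hφ x y hxy
      rw [show φ x = i from hx, show φ y = i from hy, redCliqueMinus_w_self] at h
      omega
    · intro i j hi hj x hx y hy h2
      have hxy : x ≠ y := by
        rintro rfl
        rw [G.loopless] at h2
        omega
      have h := hφ x y hxy
      rw [show φ x = i from hx, show φ y = j from hy, h2] at h
      have hij : i ≠ j := by rintro rfl; omega
      simp only [redCliqueMinus, if_neg hij] at h
      rw [if_pos ⟨by omega, by omega⟩] at h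
      omega
  · rintro ⟨W, -, hcov, hgreen, hblue⟩
    have hex : ∀ v, ∃ i, v ∈ W i := fun v => by
      have : v ∈ ⋃ i, W i := hcov ▸ Set.mem_univ v
      simpa using this
    choose φ hφ using hex
    refine ⟨φ, fun x y hxy => ?_⟩
    have hle := G.le_two x y
    by_cases h : φ x = φ y
    · rw [hgreen (φ x) x (hφ x) y (h ▸ hφ y) hxy]
      exact Nat.zero_le _
    · have hne : (φ x).val ≠ (φ y).val := fun e => h (Fin.ext e)
      simp only [redCliqueMinus, if_neg h]
      split_ifs with h2
      · rcases Nat.eq_zero_or_pos (φ x).val with h0 | h0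
        · have := hblue (φ x) (φ y) h0 (by omega) x (hφ x) y (hφ y)
          omega
        · have := hblue (φ y) (φ x) (by omega) (by omega) y (hφ y) x (hφ x)
          rw [G.symm] at this
          omega
      · exact hle

end Partition

/-! ### The degree condition yields a homomorphism -/

section UpperBound

variable {V : Type*} [Fintype V]

theorem minDegree_le (G : ColouredGraph V) (v : V) : G.minDegree ≤ G.degree v :=
  ciInf_le (OrderBot.bddBelow _) v

theorem isDense_of_minDegree [Nonempty V] {G : ColouredGraph V} {m : ℕ}
    (hG : G.CliqueBound (2 * m + 4))
    (h : (14 * (m : ℝ) + 4) / (7 * m + 9) * Fintype.card V < G.minDegree) :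
    G.IsDense m ((7 * m + 9) / Fintype.card V) := by
  have hcard : (0 : ℝ) < Fintype.card V := by exact_mod_cast Fintype.card_pos
  have hN : (0 : ℝ) < 7 * m + 9 := by positivity
  refine ⟨by positivity, by field_simp, fun v => ?_, hG⟩
  have h1 : (G.minDegree : ℝ) ≤ ∑ z, (G.w v z : ℝ) := by
    exact_mod_cast G.minDegree_le v
  have h2 := h.trans_le h1
  rw [div_mul_eq_mul_div, div_lt_iff₀ hN] at h2
  rw [sum_sub_distrib, sum_const, card_univ, nsmul_eq_mul, div_mul_eq_mul_div, div_lt_iff₀ hcard]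
  linarith

theorem hasHom_of_minDegree {G : ColouredGraph V} {m : ℕ} (hm : 1 ≤ m)
    (hG : G.FamilyFree (family (2 * (m + 2))))
    (h : (14 * (m : ℝ) + 4) / (7 * m + 9) * Fintype.card V < G.minDegree) :
    G.HasHom (redCliqueMinus (m + 2)) := by
  rcases isEmpty_or_nonempty V with hV | hV
  · exact ⟨fun v => hV.elim v, fun v => hV.elim v⟩
  have hD := isDense_of_minDegree (m := m) (hG.cliqueBound (by omega)) h
  obtain ⟨K, q, hKq⟩ := G.exists_isBalanced hD
  classical
  obtain ⟨F⟩ := hKq.nonempty_frame hD.cliqueBound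
  have : Nonempty (Fin m) := ⟨⟨0, hm⟩⟩
  obtain ⟨φ, hφ⟩ := F.exists_colouring (ι := Fin m) (by simpa using hD)
  let ψ : Bool ⊕ Fin m → Fin (m + 2) :=
    Sum.elim (fun b => if b then 1 else 0) (fun i => ⟨i + 2, by omega⟩)
  have hψ : Function.Injective ψ := by
    rintro (a | i) (b | j) hab
    · cases a <;> cases b <;> simp_all [ψ]
    · cases a <;> simp [ψ, Fin.ext_iff] at hab
    · cases b <;> simp [ψ, Fin.ext_iff] at hab
    · simpa [ψ, Fin.ext_iff] using hab
  have hψl : ∀ s, (ψ s).val < 2 → s.isLeft := by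
    rintro (a | i) hs
    · rfl
    · simp [ψ] at hs
  refine ⟨ψ ∘ φ, fun x y _ => ?_⟩
  have hle := G.le_two x y
  simp only [Function.comp, redCliqueMinus]
  split_ifs with h1 h2
  · exact ((hφ x y).1 (hψ h1)).le
  · have := (hφ x y).2 (hψl _ h2.1) (hψl _ h2.2)
    omega
  · exact hle

end UpperBound

/-! ### The extremal graphs -/

section Extremal

/-- The colours between the first four classes of the extremal graph. -/
def coreWeight : Fin 4 → Fin 4 → ℕ :=
  ![![0, 0, 1, 2], ![0, 0, 2, 1], ![1, 2, 0, 2], ![2, 1, 2, 0]]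

/-- The reduced extremal graph: four vertices coloured by `coreWeight` and `s` further vertices
that are red to everything. -/
def pattern (s : ℕ) : ColouredGraph (Fin 4 ⊕ Fin s) where
  w
    | .inl i, .inl j => coreWeight i j
    | .inr i, .inr j => if i = j then 0 else 2
    | _, _ => 2
  symm := by
    rintro (i | i) (j | j)
    · exact (by decide : ∀ i j, coreWeight i j = coreWeight j i) i j
    · rfl
    · rfl
    · simp [eq_comm]
  loopless := by
    rintro (i | i)
    · exact (by decide : ∀ i, coreWeight i i = 0) i
    · simp
  le_two := by
    rintro (i | i) (j | j)
    · exact (by decide : ∀ i j, coreWeight i j ≤ 2) i j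
    · rfl
    · rfl
    · dsimp only; split_ifs <;> omega

/-- The blow-up of `H` along `f`. -/
def blowUp {V L : Type*} (H : ColouredGraph L) (f : V → L) : ColouredGraph V where
  w x y := H.w (f x) (f y)
  symm _ _ := H.symm _ _
  loopless _ := H.loopless _
  le_two _ _ := H.le_two _ _

/-- The proper colouring of the reduced extremal graph with `s + 3` colours. -/
def merge (s : ℕ) : Fin 4 ⊕ Fin s → Fin 3 ⊕ Fin s := Sum.map ![0, 0, 1, 2] id

theorem pattern_eq_zero_of_merge {s : ℕ} {x y : Fin 4 ⊕ Fin s} (h : merge s x = merge s y) :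
    (pattern s).w x y = 0 := by
  rcases x with i | i <;> rcases y with j | j
  · simp only [merge, Sum.map_inl, Sum.inl.injEq] at h
    change coreWeight i j = 0
    revert i j; decide
  · simp [merge] at h
  · simp [merge] at h
  · simp only [merge, Sum.map_inr, id, Sum.inr.injEq] at h
    simp [pattern, h]

/-- `merge` properly colours the non-green edges with r colours, so a ≤ r and hence a = b = r. A red
clique on r vertices must use classes 2 and 3 and one of 0, 1; but 02 and 13 are blue. -/
theorem familyFree_blowUp {V : Type*} {s : ℕ} (f : V → Fin 4 ⊕ Fin s) :
    ((pattern s).blowUp f).FamilyFree (family (2 * (s + 3))) := by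
  rintro _ ⟨a, b, hb, hba, hab, rfl⟩ ⟨S, H, hH, φ, hφ⟩
  have hw : ∀ i j, (cliqueGraph a b).w i j ≤ (pattern s).w (f (φ i)) (f (φ j)) := fun i j =>
    (hφ i j).le.trans (hH _ _)
  have hinj : Function.Injective fun i => merge s (f (φ i)) := by
    intro i j hij
    by_contra hne
    have h := hw i j
    rw [pattern_eq_zero_of_merge hij] at h
    simp only [cliqueGraph, if_neg hne] at h
    split_ifs at h <;> omega
  have hcard := Fintype.card_le_of_injective _ hinj
  simp only [Fintype.card_fin, Fintype.card_sum] at hcard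
  have ha : a = s + 3 := by omega
  have hbij := (Fintype.bijective_iff_injective_and_card _).2
    ⟨hinj, by simp only [Fintype.card_fin, Fintype.card_sum]; omega⟩
  have hred : ∀ i j : Fin a, i ≠ j → (pattern s).w (f (φ i)) (f (φ j)) = 2 := by
    intro i j hij
    have h := hw i j
    simp only [cliqueGraph, if_neg hij] at h
    rw [if_pos ⟨by omega, by omega⟩] at h
    exact le_antisymm ((pattern s).le_two _ _) h
  have hex : ∀ k : Fin 3, ∃ i : Fin a, ∃ l : Fin 4, f (φ i) = Sum.inl l ∧
      (![0, 0, 1, 2] : Fin 4 → Fin 3) l = k := by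
    intro k
    obtain ⟨i, hi⟩ := hbij.2 (Sum.inl k)
    rcases hl : f (φ i) with l | l
    · simp only [hl, merge, Sum.map_inl, Sum.inl.injEq] at hi
      exact ⟨i, l, hl, hi⟩
    · simp [hl, merge] at hi
  obtain ⟨i₀, l₀, h₀, e₀⟩ := hex 0
  obtain ⟨i₁, l₁, h₁, e₁⟩ := hex 1
  obtain ⟨i₂, l₂, h₂, e₂⟩ := hex 2
  have hne : ∀ i j l l', f (φ i) = Sum.inl l → f (φ j) = Sum.inl l' →
      (![0, 0, 1, 2] : Fin 4 → Fin 3) l ≠ (![0, 0, 1, 2] : Fin 4 → Fin 3) l' →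
      coreWeight l l' = 2 := by
    intro i j l l' hi hj hll
    have h := hred i j (by rintro rfl; rw [hi] at hj; exact hll (by rw [Sum.inl.inj hj]))
    rw [hi, hj] at h
    exact h
  have h01 := hne _ _ _ _ h₀ h₁ (by rw [e₀, e₁]; decide)
  have h02 := hne _ _ _ _ h₀ h₂ (by rw [e₀, e₂]; decide)
  clear hne h₀ h₁ h₂
  revert l₀ l₁ l₂
  decide

/-- In a homomorphism to `RK_r⁻` of a graph on `r` vertices with at most one blue edge and no green
edges, the ends of the blue edge are mapped to the ends of the blue edge. -/
theorem val_lt_two_iff {s : ℕ} (g : Fin 3 ⊕ Fin s → Fin (s + 3))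
    (h1 : ∀ i j, i ≠ j → (redCliqueMinus (s + 3)).w (g i) (g j) ≠ 0)
    (h2 : ∀ i j, i ≠ j → ¬ (i = .inl 0 ∧ j = .inl 1) → ¬ (i = .inl 1 ∧ j = .inl 0) →
      (redCliqueMinus (s + 3)).w (g i) (g j) = 2) :
    (g (.inl 1)).val < 2 ∧ 2 ≤ (g (.inl 2)).val := by
  have hinj : Function.Injective g := by
    intro i j hij
    by_contra hne
    exact h1 i j hne (by rw [hij, redCliqueMinus_w_self])
  have hbij := (Fintype.bijective_iff_injective_and_card g).2
    ⟨hinj, by simp only [Fintype.card_fin, Fintype.card_sum]; omega⟩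
  obtain ⟨i, hi⟩ := hbij.2 ⟨0, by omega⟩
  obtain ⟨j, hj⟩ := hbij.2 ⟨1, by omega⟩
  have hij : i ≠ j := by
    rintro rfl; rw [hi] at hj; simp at hj
  have hw : (redCliqueMinus (s + 3)).w (g i) (g j) ≠ 2 := by
    rw [hi, hj]; simp [redCliqueMinus]
  have hcase : (i = .inl 0 ∧ j = .inl 1) ∨ (i = .inl 1 ∧ j = .inl 0) := by
    by_contra hcon
    push Not at hcon
    exact hw (h2 i j hij (fun h => hcon.1 h.1 h.2) (fun h => hcon.2 h.1 h.2))
  have hne0 : g (.inl 2) ≠ g (.inl 0) := hinj.ne (by simp)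
  have hne1 : g (.inl 2) ≠ g (.inl 1) := hinj.ne (by simp)
  rw [ne_eq, Fin.ext_iff] at hne0 hne1
  rcases hcase with ⟨rfl, rfl⟩ | ⟨rfl, rfl⟩ <;> rw [Fin.ext_iff] at hi hj <;>
    simp only at hi hj <;> omega

/-- Classes 0, 2, 3 and classes 1, 3, 2, each with all the further ones, give two copies of `RK_r⁻`.
The first sends class 3 off the blue edge of the target, the second sends it to an end of that edge.
-/
theorem not_hasHom_blowUp {V : Type*} {s : ℕ} (f : V → Fin 4 ⊕ Fin s)
    (hf : Function.Surjective f) :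
    ¬ ((pattern s).blowUp f).HasHom (redCliqueMinus (s + 3)) := by
  rintro ⟨φ, hφ⟩
  obtain ⟨t, ht⟩ := hf.hasRightInverse
  have hle : ∀ x y, x ≠ y → (pattern s).w x y ≤ (redCliqueMinus (s + 3)).w (φ (t x)) (φ (t y)) := by
    intro x y hxy
    have h := hφ (t x) (t y) (ht.injective.ne hxy)
    simpa only [blowUp, ht x, ht y] using h
  have key : ∀ ρ : Fin 3 → Fin 4, Function.Injective ρ →
      (∀ i j, i ≠ j → coreWeight (ρ i) (ρ j) ≠ 0) →
      (∀ i j, i ≠ j → ¬ (i = 0 ∧ j = 1) → ¬ (i = 1 ∧ j = 0) → coreWeight (ρ i) (ρ j) = 2) →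
      (φ (t (.inl (ρ 1)))).val < 2 ∧ 2 ≤ (φ (t (.inl (ρ 2)))).val := by
    intro ρ hρ h1 h2
    have hinj : Function.Injective (Sum.map ρ id : Fin 3 ⊕ Fin s → Fin 4 ⊕ Fin s) :=
      hρ.sumMap Function.injective_id
    refine val_lt_two_iff (fun i => φ (t (Sum.map ρ id i))) (fun i j hij h0 => ?_)
      (fun i j hij ha hb => ?_)
    · have h := hle _ _ (hinj.ne hij)
      rw [h0] at h
      rcases i with i | i <;> rcases j with j | j
      · exact h1 i j (fun e => hij (by rw [e])) (Nat.le_zero.1 h)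
      · simp [pattern] at h
      · simp [pattern] at h
      · have : i ≠ j := fun e => hij (by rw [e])
        simp [pattern, this] at h
    · have h := hle _ _ (hinj.ne hij)
      refine le_antisymm ((redCliqueMinus _).le_two _ _) (le_trans (Eq.ge ?_) h)
      rcases i with i | i <;> rcases j with j | j
      · exact h2 i j (fun e => hij (by rw [e])) (fun e => ha (by simp [e.1, e.2]))
          (fun e => hb (by simp [e.1, e.2]))
      · rfl
      · rfl
      · have : i ≠ j := fun e => hij (by rw [e])
        simp [pattern, this]
  have k1 := key ![0, 2, 3] (by decide) (by decide) (by decide)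
  have k2 := key ![1, 3, 2] (by decide) (by decide) (by decide)
  have e1 : (![0, 2, 3] : Fin 3 → Fin 4) 2 = 3 := rfl
  have e2 : (![1, 3, 2] : Fin 3 → Fin 4) 1 = 3 := rfl
  rw [e1] at k1
  rw [e2] at k2
  omega

/-- The vertices of the extremal graph, without multiplicity. -/
abbrev ExtremalBase (s : ℕ) : Type :=
  (Fin 2 ⊕ Fin 2 ⊕ Fin 6 ⊕ Fin 6) ⊕ (Fin s × Fin 7)

/-- The class of a vertex of the extremal graph. -/
def extremalClass (s : ℕ) : ExtremalBase s → Fin 4 ⊕ Fin s :=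
  Sum.map (Sum.elim (fun _ => 0) (Sum.elim (fun _ => 1) (Sum.elim (fun _ => 2) fun _ => 3)))
    Prod.fst

theorem extremalClass_surjective (s : ℕ) : Function.Surjective (extremalClass s) := by
  rintro (i | i)
  · fin_cases i
    · exact ⟨.inl (.inl 0), rfl⟩
    · exact ⟨.inl (.inr (.inl 0)), rfl⟩
    · exact ⟨.inl (.inr (.inr (.inl 0))), rfl⟩
    · exact ⟨.inl (.inr (.inr (.inr 0))), rfl⟩
  · exact ⟨.inr (i, 0), rfl⟩

/-- The class sizes 2, 2, 6, 6 and 7 make the blow-up regular. -/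
theorem sum_pattern {s : ℕ} (x : Fin 4 ⊕ Fin s) :
    ∑ y : ExtremalBase s, (pattern s).w x (extremalClass s y) = 14 * s + 18 := by
  rcases x with i | i
  · simp only [Fintype.sum_sum_type, extremalClass, Sum.map_inl, Sum.map_inr,
      Sum.elim_inl, Sum.elim_inr, pattern, sum_const, card_univ, Fintype.card_fin,
      Fintype.card_prod, smul_eq_mul]
    have : ∀ i : Fin 4, 2 * coreWeight i 0 + (2 * coreWeight i 1 +
      (6 * coreWeight i 2 + 6 * coreWeight i 3)) = 18 := by decide
    rw [this i]
    ring
  · simp only [Fintype.sum_sum_type, Fintype.sum_prod_type, extremalClass, Sum.map_inl,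
      Sum.map_inr, pattern, sum_const, card_univ, Fintype.card_fin, Fintype.card_sum, smul_eq_mul]
    have h : ∑ j : Fin s, ∑ _l : Fin 7, (if i = j then 0 else 2) + 14 = 14 * s := by
      simp only [sum_const, card_univ, Fintype.card_fin, smul_eq_mul]
      rw [← add_sum_erase univ _ (mem_univ i),
        sum_congr rfl (g := fun _ => 14) fun j hj => by
          rw [if_neg (ne_of_mem_erase hj).symm]]
      simp only [if_true, sum_const, card_erase_of_mem (mem_univ i), card_univ, Fintype.card_fin,
        smul_eq_mul]
      have := i.2
      omega
    omega

theorem exists_extremal (s k : ℕ) (hk : 0 < k) :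
    ∃ G : ColouredGraph (Fin (k * (7 * s + 16))),
      G.FamilyFree (family (2 * (s + 3))) ∧ G.minDegree = k * (14 * s + 18) ∧
        ¬ G.HasHom (redCliqueMinus (s + 3)) := by
  have hcard : Fintype.card (Fin (k * (7 * s + 16))) = Fintype.card (Fin k × ExtremalBase s) := by
    simp only [Fintype.card_fin, Fintype.card_prod, Fintype.card_sum]
    ring
  let e := Fintype.equivOfCardEq hcard
  let f : Fin (k * (7 * s + 16)) → Fin 4 ⊕ Fin s := fun x => extremalClass s (e x).2
  refine ⟨(pattern s).blowUp f, familyFree_blowUp f, ?_, not_hasHom_blowUp f fun l => ?_⟩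
  · have hdeg : ∀ x, ((pattern s).blowUp f).degree x = k * (14 * s + 18) := by
      intro x
      have h := e.sum_comp fun y => (pattern s).w (f x) (extremalClass s y.2)
      rw [degree]
      refine h.trans ?_
      rw [Fintype.sum_prod_type]
      simp only [sum_pattern, sum_const, card_univ, Fintype.card_fin, smul_eq_mul]
    have : Nonempty (Fin (k * (7 * s + 16))) := ⟨⟨0, by positivity⟩⟩
    simp only [minDegree, hdeg, ciInf_const]
  · obtain ⟨y, hy⟩ := extremalClass_surjective s l
    exact ⟨e.symm (⟨0, hk⟩, y), by simpa [f] using hy⟩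

end Extremal

end ColouredGraph

/-! ### Assembly, with m = s + 1 and r = s + 3 -/

theorem theorem1p6 (r : ℕ) (hr : 3 ≤ r) :
    -- the minimum degree condition forces a homomorphism to `RK_r⁻`
    (∀ (V : Type*) [Fintype V] (G : ColouredGraph V),
      G.FamilyFree (ColouredGraph.family (2 * r)) →
      (14 * (r : ℝ) - 24) / (7 * (r : ℝ) - 5) * (Fintype.card V : ℝ) < (G.minDegree : ℝ) →
        G.HasHom (ColouredGraph.redCliqueMinus r) ∧
        ∃ W : Fin r → Set V, G.IsMinusPartition W) ∧
    -- homomorphisms to `RK_r⁻` and partitions are equivalent for every coloured graph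
    (∀ (V : Type*) [Fintype V] (G : ColouredGraph V),
      G.HasHom (ColouredGraph.redCliqueMinus r) ↔
        ∃ W : Fin r → Set V, G.IsMinusPartition W) ∧
    -- for every positive multiple `n` of `7r - 5`, strict inequality cannot be relaxed
    (∀ n : ℕ, 0 < n → (7 * r - 5) ∣ n →
      ∃ G : ColouredGraph (Fin n),
        G.FamilyFree (ColouredGraph.family (2 * r)) ∧
        (G.minDegree : ℝ) = (14 * (r : ℝ) - 24) / (7 * (r : ℝ) - 5) * (n : ℝ) ∧
        ¬ G.HasHom (ColouredGraph.redCliqueMinus r)) ∧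
    -- the constant is the least possible one
    IsLeast {α : ℝ | ∀ (n : ℕ) (G : ColouredGraph (Fin n)),
        G.FamilyFree (ColouredGraph.family (2 * r)) →
        α * (n : ℝ) < (G.minDegree : ℝ) →
        G.HasHom (ColouredGraph.redCliqueMinus r)}
      ((14 * (r : ℝ) - 24) / (7 * (r : ℝ) - 5)) := by
  obtain ⟨s, rfl⟩ : ∃ s, r = s + 3 := ⟨r - 3, by omega⟩
  have e1 : 14 * ((s + 3 : ℕ) : ℝ) - 24 = 14 * ((s + 1 : ℕ) : ℝ) + 4 := by push_cast; ring
  have e2 : 7 * ((s + 3 : ℕ) : ℝ) - 5 = 7 * ((s + 1 : ℕ) : ℝ) + 9 := by push_cast; ring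
  have hsharp : ∀ n : ℕ, 0 < n → (7 * (s + 3) - 5) ∣ n →
      ∃ G : ColouredGraph (Fin n),
        G.FamilyFree (ColouredGraph.family (2 * (s + 3))) ∧
        (G.minDegree : ℝ) =
          (14 * ((s + 3 : ℕ) : ℝ) - 24) / (7 * ((s + 3 : ℕ) : ℝ) - 5) * (n : ℝ) ∧
        ¬ G.HasHom (ColouredGraph.redCliqueMinus (s + 3)) := by
    rintro n hn ⟨k, rfl⟩
    have hk : 0 < k := Nat.pos_of_mul_pos_left hn
    have hnk : (7 * (s + 3) - 5) * k = k * (7 * s + 16) := by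
      rw [mul_comm, show 7 * (s + 3) - 5 = 7 * s + 16 by omega]
    rw [hnk]
    obtain ⟨G, h1, h2, h3⟩ := ColouredGraph.exists_extremal s k hk
    refine ⟨G, h1, ?_, h3⟩
    rw [h2, e1, e2]
    push_cast
    have : (0 : ℝ) < 7 * (s + 1) + 9 := by positivity
    field_simp
    ring
  refine ⟨fun V _ G hG h => ?_, fun V _ G => G.hasHom_iff_exists_partition _, hsharp, ?_, ?_⟩
  · rw [e1, e2] at h
    have := ColouredGraph.hasHom_of_minDegree (m := s + 1) (by omega) hG h
    exact ⟨this, (G.hasHom_iff_exists_partition _).1 this⟩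
  · intro n G hG h
    rw [e1, e2] at h
    exact ColouredGraph.hasHom_of_minDegree (m := s + 1) (by omega) hG (by simpa using h)
  · intro α hα
    by_contra! hlt
    obtain ⟨G, h1, h2, h3⟩ := hsharp (7 * (s + 3) - 5) (by omega) dvd_rfl
    refine h3 (hα _ G h1 ?_)
    rw [h2]
    exact mul_lt_mul_of_pos_right hlt (by exact_mod_cast (by omega : 0 < 7 * (s + 3) - 5))
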